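/- Let $\alpha>1/2$, $\beta>1/2$ with $\beta\neq 3/4$, $C_0>0$ and $C_{\xi,\alpha}>0$. Let $n,p\ge 1$, let $(\xi_{i,j})$, $i\in\mathbb Z$, $1\le j\le p$, be i.i.d. real random variables with mean zero and variance one such that $\|\xi_{1,1}\|_q=(\mathbb E|\xi_{1,1}|^q)^{1/q}\le C_{\xi,\alpha}\,q^{\alpha}$ for all real $q\ge 1$, and let $$\mathbf x_i=\boldsymbol\mu+\sum_{m=0}^\infty A_m\boldsymbol\xi_{i-m},\qquad \boldsymbol\xi_i=(\xi_{i,1},\dots,\xi_{i,p})^\top,\quad i\in\mathbb Z,$$ where the $p\times p$ matrices $A_m=(a_{m,jk})$ satisfy $\max_{1\le j\le p}\big(\sum_{k=1}^p a_{m,jk}^2\big)^{1/2}\le C_0(1\vee m)^{-\beta}$ for all $m\ge 0$. Assume that $\Sigma=\mathrm{cov}(\mathbf x_i)$ is invertible. Let $\hat S_n=n^{-1}\sum_{i=1}^n(\mathbf x_i-\boldsymbol\mu)(\mathbf x_i-\boldsymbol\mu)^\top$ (known mean) or $\hat S_n=n^{-1}\sum_{i=1}^n(\mathbf x_i-\bar{\mathbf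 x})(\mathbf x_i-\bar{\mathbf x})^\top$ with $\bar{\mathbf x}=n^{-1}\sum_{i=1}^n\mathbf x_i$ (unknown mean). Let $\mathbf b\in\mathbb R^p$, $\boldsymbol\theta=\Sigma^{-1}\mathbf b$, and let $\hat{\mathbf b}$ be a random vector in $\mathbb R^p$ with $$\mathbb P\big(|\hat{\mathbf b}-\mathbf b|_\infty>c_br_b\big)\le 2p^{-C_b},\qquad c_b>0,\ r_b\ge 0,\ C_b\in(0,\infty],$$ where $p^{-\infty}$ is read as $0$ (so that $\hat{\mathbf b}=\mathbf b$ is covered by $r_b=0$, $C_b=\infty$). Let $\hat{\boldsymbol\theta}(\lambda)$ denote a minimizer of $|\boldsymbol\eta|_1$ over $\{\boldsymbol\eta\in\mathbb R^p:|\hat S_n\boldsymbol\eta-\hat{\mathbf b}|_\infty\le\lambda\}$. Write $|\Sigma^{-1}|_{L^1}$ for the maximal absolute column sum of $\Sigma^{-1}$, $D(u)=\sum_{j=1}^p\min(|\theta_j|,u)$, $\beta'=\min(2\beta-1,1/2)$ and $J_{n,p,\beta,\alpha}=n^{-\beta'}(\log p)^{2\alpha+2}$. Then there are constants $C_1,C_2,C_3>0$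 depending only on $\alpha,\beta,C_0,C_{\xi,\alpha}$ such that for every $\lambda\ge c_br_b+C_1|\boldsymbol\theta|_1J_{n,p,\beta,\alpha}$, with probability at least $1-2p^{-C_b}-C_2p^{-C_3}$, a minimizer $\hat{\boldsymbol\theta}=\hat{\boldsymbol\theta}(\lambda)$ exists and every minimizer satisfies, for all $1\le w\le\infty$, $$|\hat{\boldsymbol\theta}-\boldsymbol\theta|_w\le\big[6D(5|\Sigma^{-1}|_{L^1}\lambda)\big]^{1/w}\big(2|\Sigma^{-1}|_{L^1}\lambda\big)^{1-1/w}.$$ -/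

import Mathlib

open MeasureTheory ProbabilityTheory Filter Topology Matrix
open scoped ENNReal

namespace LinFunctional

noncomputable section

/-- The innovations `ξ i k` (`i ∈ ℤ`, `k` a coordinate) are i.i.d. real random variables with
mean zero and variance one. -/
structure IsInnovationArray {Ω : Type*} [MeasurableSpace Ω] (P : Measure Ω) {p : ℕ}
    (ξ : ℤ → Fin p → Ω → ℝ) : Prop where
  measurable : ∀ i k, Measurable (ξ i k)
  indep : iIndepFun (fun a : ℤ × Fin p => ξ a.1 a.2) P
  identDistrib : ∀ i k i' k', IdentDistrib (ξ i k) (ξ i' k') P P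
  mean_zero : ∀ i k, ∫ ω, ξ i k ω ∂P = 0
  variance_one : ∀ i k, variance (ξ i k) P = 1

/-- Generalized sub-exponential innovations: `‖ξ‖_q ≤ C q ^ α` for all real `q ≥ 1`. -/
def SubExponential {Ω : Type*} [MeasurableSpace Ω] (P : Measure Ω) {p : ℕ}
    (ξ : ℤ → Fin p → Ω → ℝ) (α C : ℝ) : Prop :=
  ∀ i k, ∀ q : ℝ, 1 ≤ q →
    eLpNorm (ξ i k) (ENNReal.ofReal q) P ≤ ENNReal.ofReal (C * q ^ α)

/-- The Euclidean norm of every row of `A m` is at most `C₀ (1 ∨ m) ^ (-β)`. -/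
def DecayCondition {p : ℕ} (A : ℕ → Matrix (Fin p) (Fin p) ℝ) (β C₀ : ℝ) : Prop :=
  ∀ (m : ℕ) (j : Fin p), √(∑ k, A m j k ^ 2) ≤ C₀ * (max 1 (m : ℝ)) ^ (-β)

/-- `x i = mean + ∑_{m ≥ 0} A m ξ (i - m)` for all `i ∈ ℤ`. The series is read as the limit in
probability of its partial sums, coordinate by coordinate, which is implied both by almost sure
convergence and by convergence in mean square. -/
def IsLinearProcess {Ω : Type*} [MeasurableSpace Ω] (P : Measure Ω) {p : ℕ}
    (A : ℕ → Matrix (Fin p) (Fin p) ℝ) (mean : Fin p → ℝ) (ξ : ℤ → Fin p → Ω → ℝ)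
    (x : ℤ → Ω → Fin p → ℝ) : Prop :=
  ∀ (i : ℤ) (j : Fin p),
    TendstoInMeasure P
      (fun (N : ℕ) ω => mean j + ∑ m ∈ Finset.range N, (A m *ᵥ fun k => ξ (i - m) k ω) j)
      atTop (fun ω => x i ω j)

/-- The covariance matrix of a random vector. -/
def covMatrix {Ω : Type*} [MeasurableSpace Ω] (P : Measure Ω) {p : ℕ} (X : Ω → Fin p → ℝ) :
    Matrix (Fin p) (Fin p) ℝ :=
  Matrix.of fun j k => covariance (fun ω => X ω j) (fun ω => X ω k) P

/-- The sample mean of `x 1, …, x n`. -/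
def sampleMean {Ω : Type*} {p : ℕ} (x : ℤ → Ω → Fin p → ℝ) (n : ℕ) (ω : Ω) : Fin p → ℝ :=
  (n : ℝ)⁻¹ • ∑ i ∈ Finset.Icc (1 : ℤ) n, x i ω

/-- `n⁻¹ ∑_{i=1}^n (x i - c) (x i - c)ᵀ`, the sample second moment matrix about the point `c`. -/
def sampleCov {Ω : Type*} {p : ℕ} (x : ℤ → Ω → Fin p → ℝ) (n : ℕ) (c : Fin p → ℝ) (ω : Ω) :
    Matrix (Fin p) (Fin p) ℝ :=
  (n : ℝ)⁻¹ • ∑ i ∈ Finset.Icc (1 : ℤ) n, vecMulVec (x i ω - c) (x i ω - c)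

/-- `S` is the sample covariance matrix of `x 1, …, x n`: centred at the true mean (mean known)
or at the sample mean (mean unknown). -/
def IsSampleCovariance {Ω : Type*} {p : ℕ} (x : ℤ → Ω → Fin p → ℝ) (n : ℕ) (mean : Fin p → ℝ)
    (S : Ω → Matrix (Fin p) (Fin p) ℝ) : Prop :=
  (∀ ω, S ω = sampleCov x n mean ω) ∨ (∀ ω, S ω = sampleCov x n (sampleMean x n ω) ω)

/-- `|v|₁`. -/
def l1 {p : ℕ} (v : Fin p → ℝ) : ℝ := ∑ j, |v j|

/-- `|v|_w` for `w ∈ [1, ∞]`. -/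
def lw {p : ℕ} (w : ℝ≥0∞) (v : Fin p → ℝ) : ℝ := ‖WithLp.toLp w v‖

/-- `max_k ∑_j |M j k|`. -/
def matL1 {p : ℕ} (M : Matrix (Fin p) (Fin p) ℝ) : ℝ := ⨆ k, ∑ j, |M j k|

/-- The smallness measure `D(u) = ∑_j (|θ_j| ∧ u)`. -/
def smallness {p : ℕ} (θ : Fin p → ℝ) (u : ℝ) : ℝ := ∑ j, min |θ j| u

/-- The set of all minimizers of `|η|₁` subject to `|S η - b|_∞ ≤ lam` (the norm of
`Fin p → ℝ` is the maximum norm). -/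
def dantzigArgmin {p : ℕ} (S : Matrix (Fin p) (Fin p) ℝ) (b : Fin p → ℝ) (lam : ℝ) :
    Set (Fin p → ℝ) :=
  {η | ‖S *ᵥ η - b‖ ≤ lam ∧ ∀ η' : Fin p → ℝ, ‖S *ᵥ η' - b‖ ≤ lam → l1 η ≤ l1 η'}

/-- `2 p ^ (-C)` for `C ∈ (0, ∞]`, with the value `0` for `C = ∞`. -/
def tailBound (p : ℕ) (C : ℝ≥0∞) : ℝ :=
  if C = ∞ then 0 else 2 * (p : ℝ) ^ (-C.toReal)

/-- `J = n ^ (-β') (log p) ^ (2 α + 2)` with `β' = min (2 β - 1) (1 / 2)`. -/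
def rateJ (n p : ℕ) (β α : ℝ) : ℝ :=
  (n : ℝ) ^ (-(min (2 * β - 1) (1 / 2))) * Real.log p ^ (2 * α + 2)

end

end LinFunctional

open LinFunctional

namespace LinFunctional

/-! The argument separates a deterministic part from a concentration bound.

Deterministic part (`dantzig_error_bound`). If the entries of `S - Sig` are at most `e`, if `‖bh -
b‖ ≤ c` and `c + |θ|₁ e ≤ lam`, then `θ` is feasible, so every minimizer `η` has `|η|₁ ≤ |θ|₁`.
Hence `Sig (η - θ)` has maximum norm at most `2 lam`, and applying `Sig⁻¹` bounds `η - θ` in maximum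
norm. Together with `|η|₁ ≤ |θ|₁` this bounds `|η - θ|₁` by a multiple of `D`, and interpolation
between the two norms gives every `w`.

Concentration (`exists_sampleCovariance_tail_le`). With the process cut to `N` lags, an entry of the
centred sample covariance is a centred quadratic form in independent innovations. Adding the
variables one at a time and using the two-term inequality `lpNorm_add_sq_le` bounds its `L^{2r}`
norm by `10 r² K²` times the Frobenius norm of the coefficients, where `K ≥ 1` bounds the `L^{4r}`
norms of the innovations. The squared Frobenius norm is an average of products of autocovariances of
order `(1 ∨ |i - i'|)^{-(2β-1)}`, hence of order `n^{-2β'}`; `β ≠ 3/4` rules out a logarithm. A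
product of sample means, present when the mean is unknown, is treated as a product of linear forms.
All bounds are uniform in `N` and pass to the limit as tail bounds.

With `r = ⌈log p⌉` and `K` of order `r ^ α` the moment bound has the order of `rateJ`. Markov's
inequality at `e²` times this bound gives `p⁻⁴` per entry, and the union over `p²` entries gives
`p⁻²`. -/

/-! ### Deterministic error bound for the Dantzig-type estimator. -/

lemma l1_nonneg {p : ℕ} (v : Fin p → ℝ) : 0 ≤ l1 v := Finset.sum_nonneg fun _ _ => abs_nonneg _

lemma norm_le_l1 {p : ℕ} (v : Fin p → ℝ) : ‖v‖ ≤ l1 v :=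
  (pi_norm_le_iff_of_nonneg (l1_nonneg v)).2 fun j =>
    Finset.single_le_sum (f := fun j => |v j|) (fun _ _ => abs_nonneg _) (Finset.mem_univ j)

lemma norm_mulVec_le_of_entry_le {p : ℕ} (M : Matrix (Fin p) (Fin p) ℝ) (v : Fin p → ℝ) {e : ℝ}
    (he : 0 ≤ e) (hM : ∀ j k, |M j k| ≤ e) : ‖M *ᵥ v‖ ≤ l1 v * e := by
  refine (pi_norm_le_iff_of_nonneg (mul_nonneg (l1_nonneg v) he)).2 fun j => ?_
  rw [Real.norm_eq_abs, mulVec, dotProduct, l1, Finset.sum_mul]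
  refine (Finset.abs_sum_le_sum_abs _ _).trans (Finset.sum_le_sum fun k _ => ?_)
  rw [abs_mul, mul_comm]
  exact mul_le_mul_of_nonneg_left (hM j k) (abs_nonneg _)

lemma matL1_nonneg {p : ℕ} (M : Matrix (Fin p) (Fin p) ℝ) : 0 ≤ matL1 M :=
  Real.iSup_nonneg fun _ => Finset.sum_nonneg fun _ _ => abs_nonneg _

/-- The maximum norm is governed by row sums, whereas `matL1` takes column sums; symmetry identifies
the two. -/
lemma norm_mulVec_le_matL1 {p : ℕ} (M : Matrix (Fin p) (Fin p) ℝ) (hM : Mᵀ = M)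
    (v : Fin p → ℝ) : ‖M *ᵥ v‖ ≤ matL1 M * ‖v‖ := by
  refine (pi_norm_le_iff_of_nonneg (mul_nonneg (matL1_nonneg M) (norm_nonneg v))).2 fun j => ?_
  have h1 : ∑ k, |M j k| ≤ matL1 M := by
    have := le_ciSup (f := fun k => ∑ j, |M j k|) (Set.finite_range _).bddAbove j
    refine le_trans (le_of_eq ?_) this
    exact Finset.sum_congr rfl fun k _ => by
      rw [show M k j = M j k from congrFun (congrFun hM j) k]
  refine le_trans ?_ (mul_le_mul_of_nonneg_right h1 (norm_nonneg v))
  rw [Real.norm_eq_abs, mulVec, dotProduct, Finset.sum_mul]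
  refine (Finset.abs_sum_le_sum_abs _ _).trans (Finset.sum_le_sum fun k _ => ?_)
  rw [abs_mul]
  exact mul_le_mul_of_nonneg_left (norm_le_pi_norm v k) (abs_nonneg _)

lemma continuous_l1 {p : ℕ} : Continuous (l1 : (Fin p → ℝ) → ℝ) := by
  unfold l1; fun_prop

/-- Competitors with `l1` at most `l1 θ` lie in a compact ball, and all others lose to `θ`; so
minimizing over the compact part suffices. -/
lemma dantzigArgmin_nonempty {p : ℕ} (S : Matrix (Fin p) (Fin p) ℝ) (b : Fin p → ℝ) (lam : ℝ)
    (θ : Fin p → ℝ) (hθ : ‖S *ᵥ θ - b‖ ≤ lam) : (dantzigArgmin S b lam).Nonempty := by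
  have hcont : Continuous fun η : Fin p → ℝ => S *ᵥ η - b :=
    (Continuous.matrix_mulVec continuous_const continuous_id).sub continuous_const
  have hcl : IsClosed {η : Fin p → ℝ | ‖S *ᵥ η - b‖ ≤ lam} :=
    isClosed_le hcont.norm continuous_const
  have hcomp : IsCompact ({η : Fin p → ℝ | ‖S *ᵥ η - b‖ ≤ lam} ∩ Metric.closedBall 0 (l1 θ)) :=
    (isCompact_closedBall _ _).inter_left hcl
  obtain ⟨η, hη, hmin⟩ := hcomp.exists_isMinOn
    ⟨θ, hθ, by simpa using norm_le_l1 θ⟩ continuous_l1.continuousOn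
  refine ⟨η, hη.1, fun η' hη' => ?_⟩
  by_cases h : l1 η' ≤ l1 θ
  · exact hmin ⟨hη', by simpa using (norm_le_l1 η').trans h⟩
  · exact (hmin ⟨hθ, by simpa using norm_le_l1 θ⟩).trans (not_le.1 h).le

/-- For finite `w = r` the bound is the sum over `j` of `|δ j| ^ r ≤ |δ j| * t ^ (r - 1)`; for `w =
∞` the exponent of `X` is `0`. -/
lemma lw_le_interpolation {p : ℕ} (δ : Fin p → ℝ) {X t : ℝ} (h1 : l1 δ ≤ X) (ht : ‖δ‖ ≤ t)
    (w : ℝ≥0∞) (hw : 1 ≤ w) :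
    lw w δ ≤ X ^ (1 / w).toReal * t ^ (1 - (1 / w).toReal) := by
  have ht0 : 0 ≤ t := (norm_nonneg _).trans ht
  have hX0 : 0 ≤ X := (l1_nonneg _).trans h1
  by_cases hwt : w = ∞
  · subst hwt
    simpa [lw] using ht
  set r := w.toReal with hr
  have hr1 : 1 ≤ r := by
    rw [hr, ← ENNReal.toReal_one]; exact ENNReal.toReal_mono hwt hw
  have hr0 : 0 < r := by linarith
  have hinv : (1 / w).toReal = 1 / r := by simp [hr]
  rw [hinv, lw, PiLp.norm_eq_sum (by exact hr0)]
  have h2 : ∑ j, ‖(WithLp.toLp w δ) j‖ ^ r ≤ X * t ^ (r - 1) := by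
    calc ∑ j, ‖(WithLp.toLp w δ) j‖ ^ r ≤ ∑ j, |δ j| * t ^ (r - 1) := by
          refine Finset.sum_le_sum fun j _ => ?_
          simp only [Real.norm_eq_abs]
          rcases eq_or_lt_of_le (abs_nonneg (δ j)) with h | h
          · rw [← h, Real.zero_rpow hr0.ne', zero_mul]
          · have : |δ j| ^ r = |δ j| * |δ j| ^ (r - 1) := by
              rw [← Real.rpow_one_add' h.le (by linarith)]; congr 1; ring
            rw [this]
            refine mul_le_mul_of_nonneg_left ?_ h.le
            exact Real.rpow_le_rpow h.le ((norm_le_pi_norm δ j).trans ht) (by linarith)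
      _ = l1 δ * t ^ (r - 1) := by rw [l1, Finset.sum_mul]
      _ ≤ X * t ^ (r - 1) := mul_le_mul_of_nonneg_right h1 (Real.rpow_nonneg ht0 _)
  calc (∑ j, ‖(WithLp.toLp w δ) j‖ ^ r) ^ (1 / r) ≤ (X * t ^ (r - 1)) ^ (1 / r) :=
        Real.rpow_le_rpow (Finset.sum_nonneg fun _ _ => Real.rpow_nonneg (norm_nonneg _) _) h2
          (by positivity)
    _ = X ^ (1 / r) * t ^ (1 - 1 / r) := by
        rw [Real.mul_rpow hX0 (Real.rpow_nonneg ht0 _), ← Real.rpow_mul ht0]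
        congr 2; field_simp

/-- Coordinatewise: where `|θ j| ≤ u` the triangle inequality suffices, and where `|θ j| > u` both
`|η j - θ j|` and `|θ j| - |η j|` are at most `t`, so `u ≥ 2 t` absorbs them. Summation leaves `l1 η
- l1 θ ≤ 0`. -/
lemma l1_sub_le_smallness {p : ℕ} (θ η : Fin p → ℝ) {t : ℝ} (ht : ‖η - θ‖ ≤ t)
    (hl : l1 η ≤ l1 θ) {u : ℝ} (hu : 2 * t ≤ u) : l1 (η - θ) ≤ 2 * smallness θ u := by
  have ht0 : 0 ≤ t := (norm_nonneg _).trans ht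
  have key : ∀ j, |(η - θ) j| ≤ |η j| - |θ j| + 2 * min |θ j| u := by
    intro j
    have h1 : |(η - θ) j| ≤ t := (norm_le_pi_norm (η - θ) j).trans ht
    have h2 : |(η - θ) j| ≤ |η j| + |θ j| := abs_sub _ _
    have h3 : |θ j| - |η j| ≤ |(η - θ) j| := by
      rw [Pi.sub_apply, abs_sub_comm]; exact abs_sub_abs_le_abs_sub _ _
    rcases min_cases |θ j| u with ⟨h, _⟩ | ⟨h, _⟩ <;> rw [h] <;> linarith
  have : l1 (η - θ) ≤ l1 η - l1 θ + 2 * smallness θ u := by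
    rw [l1, l1, l1, smallness, Finset.mul_sum, ← Finset.sum_sub_distrib, ← Finset.sum_add_distrib]
    exact Finset.sum_le_sum fun j _ => key j
  linarith

/-- The deterministic part: if the sample matrix and the right-hand side are close to their
targets in maximum norm, the Dantzig-type estimator exists and is close to the target. -/
lemma dantzig_error_bound {p : ℕ} (S Sig : Matrix (Fin p) (Fin p) ℝ) (hsym : Sigᵀ = Sig)
    (hdet : IsUnit Sig.det) (b bh θ : Fin p → ℝ) (hθ : θ = Sig⁻¹ *ᵥ b) {e c lam : ℝ}
    (he : 0 ≤ e) (hS : ∀ j k, |S j k - Sig j k| ≤ e) (hb : ‖bh - b‖ ≤ c)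
    (hlam : c + l1 θ * e ≤ lam) :
    (dantzigArgmin S bh lam).Nonempty ∧
      ∀ θhat ∈ dantzigArgmin S bh lam, ∀ w : ℝ≥0∞, 1 ≤ w →
        lw w (θhat - θ) ≤
          (6 * smallness θ (5 * matL1 Sig⁻¹ * lam)) ^ (1 / w).toReal *
            (2 * matL1 Sig⁻¹ * lam) ^ (1 - (1 / w).toReal) := by
  have hc : 0 ≤ c := (norm_nonneg _).trans hb
  have hlam0 : 0 ≤ lam := le_trans (by have := mul_nonneg (l1_nonneg θ) he; linarith) hlam
  have hb' : Sig *ᵥ θ = b := by rw [hθ, mulVec_mulVec, mul_nonsing_inv _ hdet, one_mulVec]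
  have hdiff : ∀ η, ‖(S - Sig) *ᵥ η‖ ≤ l1 η * e := fun η =>
    norm_mulVec_le_of_entry_le _ _ he fun j k => by simpa using hS j k
  have hfeas : ‖S *ᵥ θ - bh‖ ≤ lam := by
    have : S *ᵥ θ - bh = (S - Sig) *ᵥ θ - (bh - b) := by rw [sub_mulVec, hb']; abel
    rw [this]
    refine (norm_sub_le _ _).trans ?_
    linarith [hdiff θ]
  refine ⟨dantzigArgmin_nonempty S bh lam θ hfeas, fun η hη w hw => ?_⟩
  obtain ⟨hη1, hη2⟩ := hη
  have hl : l1 η ≤ l1 θ := hη2 θ hfeas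
  set L := matL1 Sig⁻¹ with hL
  have hL0 : 0 ≤ L := matL1_nonneg _
  have hsup : ‖η - θ‖ ≤ 2 * L * lam := by
    have h1 : η - θ = Sig⁻¹ *ᵥ (Sig *ᵥ (η - θ)) := by
      rw [mulVec_mulVec, nonsing_inv_mul _ hdet, one_mulVec]
    have h2 : ‖Sig *ᵥ (η - θ)‖ ≤ 2 * lam := by
      have : Sig *ᵥ (η - θ) = (S *ᵥ η - bh) + (bh - b) - (S - Sig) *ᵥ η := by
        rw [mulVec_sub, hb', sub_mulVec]; abel
      rw [this]
      refine (norm_sub_le _ _).trans ?_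
      have h3 := norm_add_le (S *ᵥ η - bh) (bh - b)
      have h4 := hdiff η
      have h5 := mul_le_mul_of_nonneg_right hl he
      linarith
    rw [h1]
    refine (norm_mulVec_le_matL1 _ (by rw [transpose_nonsing_inv, hsym]) _).trans ?_
    rw [← hL]
    nlinarith
  refine lw_le_interpolation _ ?_ hsup w hw
  have h0 : 0 ≤ L * lam := mul_nonneg hL0 hlam0
  -- There is slack in both constants: the threshold needed is `2 t = 4 L lam`, and the bound
  -- obtained is `2 D` rather than `6 D`.
  have h6 := l1_sub_le_smallness θ η hsup hl (u := 5 * L * lam) (by nlinarith)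
  have h7 : 0 ≤ smallness θ (5 * L * lam) :=
    Finset.sum_nonneg fun j _ => le_min (abs_nonneg _) (by nlinarith)
  linarith

/-! ### Calculus of moments and a two-term inequality in `L^{2r}`. -/

section AllMoments

variable {Ω : Type*} [MeasurableSpace Ω]

/-- All absolute moments of `f` are finite. -/
def HasAllMoments (P : Measure Ω) (f : Ω → ℝ) : Prop := ∀ q : ℕ, MemLp f q P

namespace HasAllMoments

variable {P : Measure Ω} {f g : Ω → ℝ}

lemma aestronglyMeasurable (hf : HasAllMoments P f) : AEStronglyMeasurable f P := (hf 1).1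

lemma integrable (hf : HasAllMoments P f) : Integrable f P := by
  have := hf 1
  rwa [Nat.cast_one, memLp_one_iff_integrable] at this

lemma add (hf : HasAllMoments P f) (hg : HasAllMoments P g) :
    HasAllMoments P (fun ω => f ω + g ω) := fun q => (hf q).add (hg q)

lemma sub (hf : HasAllMoments P f) (hg : HasAllMoments P g) :
    HasAllMoments P (fun ω => f ω - g ω) := fun q => (hf q).sub (hg q)

lemma const [IsFiniteMeasure P] (c : ℝ) : HasAllMoments P (fun _ => c) := fun _ => memLp_const c

lemma mul (hf : HasAllMoments P f) (hg : HasAllMoments P g) :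
    HasAllMoments P (fun ω => f ω * g ω) := by
  intro q
  have : ENNReal.HolderTriple ((2 * q : ℕ) : ℝ≥0∞) ((2 * q : ℕ) : ℝ≥0∞) (q : ℝ≥0∞) := by
    constructor
    rw [Nat.cast_mul, ENNReal.mul_inv (by simp) (by simp), ← add_mul]
    simp [ENNReal.inv_two_add_inv_two]
  exact (hg (2 * q)).mul' (hf (2 * q))

lemma const_mul (hf : HasAllMoments P f) (c : ℝ) : HasAllMoments P (fun ω => c * f ω) :=
  fun q => (hf q).const_mul c

lemma sum {ι : Type*} (F : Finset ι) {f : ι → Ω → ℝ} (hf : ∀ a ∈ F, HasAllMoments P (f a)) :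
    HasAllMoments P (fun ω => ∑ a ∈ F, f a ω) := fun q =>
  memLp_finsetSum F fun a ha => hf a ha q

lemma pow [IsFiniteMeasure P] (hf : HasAllMoments P f) (k : ℕ) :
    HasAllMoments P (fun ω => f ω ^ k) := by
  induction k with
  | zero => simpa using const 1
  | succ k ih => simpa [pow_succ] using ih.mul hf

end HasAllMoments

section Moments

variable {P : Measure Ω}

/-- Even exponents remove the absolute value, so the binomial theorem becomes available under the
integral. -/
lemma lpNorm_pow_eq_integral {f : Ω → ℝ} (hf : AEStronglyMeasurable f P) {r : ℕ} (hr : 1 ≤ r) :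
    lpNorm f (2 * r : ℕ) P ^ (2 * r) = ∫ ω, f ω ^ (2 * r) ∂P := by
  have h0 : (2 * r : ℕ) ≠ 0 := by omega
  rw [lpNorm_eq_integral_norm_rpow_toReal (by exact_mod_cast h0) (ENNReal.natCast_ne_top _) hf]
  have h1 : ∀ ω, ‖f ω‖ ^ ((2 * r : ℕ) : ℝ≥0∞).toReal = f ω ^ (2 * r) := by
    intro ω
    rw [ENNReal.toReal_natCast, Real.rpow_natCast, Real.norm_eq_abs, pow_mul, sq_abs, ← pow_mul]
  simp_rw [h1]
  rw [ENNReal.toReal_natCast, Real.rpow_inv_natCast_pow ?_ h0]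
  exact integral_nonneg fun ω => by rw [pow_mul]; positivity

/-- Hölder for `|f|^q` and `|g|^q` with weights `a / q` and `k / q`; the weighted form also covers
`a = 0` and `k = 0`. -/
lemma abs_integral_pow_mul_pow_le {f g : Ω → ℝ} {q : ℕ} (hf : MemLp f q P) (hg : MemLp g q P)
    {a k : ℕ} (hq : a + k = q) (hq0 : q ≠ 0) :
    |∫ ω, f ω ^ a * g ω ^ k ∂P| ≤ lpNorm f q P ^ a * lpNorm g q P ^ k := by
  have hqR : (q : ℝ) ≠ 0 := by exact_mod_cast hq0
  have hE : ∀ (h : Ω → ℝ) (m : ℕ),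
      (∫⁻ ω, ‖h ω‖ₑ ^ (q : ℝ) ∂P) ^ ((m : ℝ) / q) = eLpNorm h q P ^ m := by
    intro h m
    rw [eLpNorm_eq_lintegral_rpow_enorm_toReal (by exact_mod_cast hq0) (ENNReal.natCast_ne_top _),
      ENNReal.toReal_natCast, ← ENNReal.rpow_natCast, ← ENNReal.rpow_mul]
    congr 1; ring
  have hP : ∀ (y : ℝ≥0∞) (m : ℕ), (y ^ (q : ℝ)) ^ ((m : ℝ) / q) = y ^ m := by
    intro y m
    rw [← ENNReal.rpow_mul, ← ENNReal.rpow_natCast]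
    congr 1; field_simp
  have h1 : ‖∫ ω, f ω ^ a * g ω ^ k ∂P‖ₑ ≤ eLpNorm f q P ^ a * eLpNorm g q P ^ k := by
    refine (enorm_integral_le_lintegral_enorm _).trans ?_
    have := ENNReal.lintegral_mul_norm_pow_le (μ := P) (f := fun ω => ‖f ω‖ₑ ^ (q : ℝ))
      (g := fun ω => ‖g ω‖ₑ ^ (q : ℝ)) (hf.1.enorm.pow_const _) (hg.1.enorm.pow_const _)
      (p := (a : ℝ) / q) (q := (k : ℝ) / q) (by positivity) (by positivity)
      (by rw [← add_div, ← Nat.cast_add, hq, div_self hqR])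
    rw [hE, hE] at this
    simp only [hP] at this
    simpa [enorm_mul, enorm_pow] using this
  rw [← ofReal_lpNorm hf, ← ofReal_lpNorm hg, ← ENNReal.ofReal_pow lpNorm_nonneg,
    ← ENNReal.ofReal_pow lpNorm_nonneg, ← ENNReal.ofReal_mul (pow_nonneg lpNorm_nonneg _),
    ← ofReal_norm, ENNReal.ofReal_le_ofReal_iff 
      (mul_nonneg (pow_nonneg lpNorm_nonneg _) (pow_nonneg lpNorm_nonneg _))] at h1
  simpa using h1

/-- If `2 x ≤ (5 r² - 1) y`, already `(x + y)² ≤ x² + 5 r² y²`. Otherwise `y = x t` with `2 r t ≤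
1`, because `4 r ≤ 5 r² - 1` (equality at `r = 1`, whence the `5`). Then `exp s ≤ 1 + s + s²` on
`[0, 1]` bounds the left side and Bernoulli's inequality the right side. -/
lemma add_pow_two_mul_sub_le {x y : ℝ} (hx : 0 ≤ x) (hy : 0 ≤ y) {r : ℕ} (hr : 1 ≤ r) :
    (x + y) ^ (2 * r) - 2 * r * x ^ (2 * r - 1) * y ≤ (x ^ 2 + 5 * r ^ 2 * y ^ 2) ^ r := by
  have hr' : (1 : ℝ) ≤ r := by exact_mod_cast hr
  by_cases h : 2 * x ≤ (5 * (r : ℝ) ^ 2 - 1) * y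
  · have h1 : (x + y) ^ (2 * r) ≤ (x ^ 2 + 5 * r ^ 2 * y ^ 2) ^ r := by
      rw [pow_mul]
      refine pow_le_pow_left₀ (by positivity) ?_ r
      nlinarith
    have h2 : 0 ≤ 2 * (r : ℝ) * x ^ (2 * r - 1) * y := by positivity
    linarith
  · push Not at h
    have hx0 : 0 < x := by
      have : 0 ≤ (5 * (r : ℝ) ^ 2 - 1) * y := mul_nonneg (by nlinarith) hy
      linarith
    obtain ⟨t, rfl⟩ : ∃ t, y = x * t := ⟨y / x, by field_simp⟩
    have ht : 0 ≤ t := by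
      by_contra hc
      push Not at hc
      nlinarith
    have hrt : 2 * r * t ≤ 1 := by
      have h3 : (5 * (r : ℝ) ^ 2 - 1) * t < 2 := by
        have : x * ((5 * (r : ℝ) ^ 2 - 1) * t) < x * 2 := by linarith
        exact lt_of_mul_lt_mul_left this hx0.le
      nlinarith
    have h4 : (1 + t) ^ (2 * r) ≤ 1 + 2 * r * t + (2 * r * t) ^ 2 := by
      have h5 : (1 + t) ^ (2 * r) ≤ Real.exp (2 * r * t) := by
        have := pow_le_pow_left₀ (by positivity) (Real.add_one_le_exp t) (2 * r)
        rw [← Real.exp_nat_mul] at this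
        push_cast at this
        rwa [add_comm] at this
      have h0 : 0 ≤ 2 * r * t := by positivity
      have := Real.abs_exp_sub_one_sub_id_le (x := 2 * r * t) (by rwa [abs_of_nonneg h0])
      have := (abs_le.1 this).2
      linarith
    have h6 : 1 + r * (5 * r ^ 2 * t ^ 2) ≤ (1 + 5 * (r : ℝ) ^ 2 * t ^ 2) ^ r :=
      one_add_mul_le_pow (by have : 0 ≤ 5 * (r : ℝ) ^ 2 * t ^ 2 := by positivity
                             linarith) r
    have h7 : (1 + t) ^ (2 * r) - 2 * r * t ≤ (1 + 5 * (r : ℝ) ^ 2 * t ^ 2) ^ r := by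
      have : (2 * r * t) ^ 2 ≤ r * (5 * (r : ℝ) ^ 2 * t ^ 2) := by
        have : 0 ≤ (r : ℝ) ^ 2 * t ^ 2 := by positivity
        nlinarith
      linarith
    have e1 : (x + x * t) ^ (2 * r) - 2 * r * x ^ (2 * r - 1) * (x * t)
        = x ^ (2 * r) * ((1 + t) ^ (2 * r) - 2 * r * t) := by
      have : x ^ (2 * r) = x ^ (2 * r - 1) * x := by rw [← pow_succ]; congr 1; omega
      rw [show x + x * t = x * (1 + t) by ring, mul_pow, mul_sub]
      nth_rewrite 3 [this]
      ring
    have e2 : (x ^ 2 + 5 * r ^ 2 * (x * t) ^ 2) ^ r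
        = x ^ (2 * r) * (1 + 5 * (r : ℝ) ^ 2 * t ^ 2) ^ r := by
      rw [pow_mul, ← mul_pow]; congr 1; ring
    rw [e1, e2]
    exact mul_le_mul_of_nonneg_left h7 (by positivity)

/-- A two-term martingale inequality in `L^{2r}`. -/
lemma lpNorm_add_sq_le [IsFiniteMeasure P] {f g : Ω → ℝ} (hf : HasAllMoments P f)
    (hg : HasAllMoments P g) {r : ℕ} (hr : 1 ≤ r) (h0 : ∫ ω, f ω ^ (2 * r - 1) * g ω ∂P = 0) :
    lpNorm (fun ω => f ω + g ω) (2 * r : ℕ) P ^ 2 ≤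
      lpNorm f (2 * r : ℕ) P ^ 2 + 5 * r ^ 2 * lpNorm g (2 * r : ℕ) P ^ 2 := by
  set x := lpNorm f (2 * r : ℕ) P with hx
  set y := lpNorm g (2 * r : ℕ) P with hy
  have hx0 : 0 ≤ x := lpNorm_nonneg
  have hy0 : 0 ≤ y := lpNorm_nonneg
  have key : lpNorm (fun ω => f ω + g ω) (2 * r : ℕ) P ^ (2 * r) ≤
      (x ^ 2 + 5 * r ^ 2 * y ^ 2) ^ r := by
    rw [lpNorm_pow_eq_integral (hf.add hg).aestronglyMeasurable hr]
    refine le_trans ?_ (add_pow_two_mul_sub_le hx0 hy0 hr)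
    have hmem : 1 ∈ Finset.range (2 * r + 1) := by simp; omega
    -- The term `k = 1` of the expansion vanishes by `h0`. Hölder bounds the others by the matching
    -- terms for `x` and `y`, which add up to `(x + y) ^ (2 r)` without its linear term.
    have e1 : ∫ ω, (f ω + g ω) ^ (2 * r) ∂P = ∑ k ∈ Finset.range (2 * r + 1),
        ((2 * r).choose k : ℝ) * ∫ ω, f ω ^ (2 * r - k) * g ω ^ k ∂P := by
      simp_rw [add_comm (f _), add_pow]
      rw [integral_finsetSum]
      · refine Finset.sum_congr rfl fun k _ => ?_
        rw [← integral_const_mul]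
        congr 1; ext ω; ring
      · intro k _
        exact (((hg.pow k).mul (hf.pow _)).mul (HasAllMoments.const _)).integrable
    have e2 : (x + y) ^ (2 * r) - 2 * r * x ^ (2 * r - 1) * y =
        ∑ k ∈ (Finset.range (2 * r + 1)).erase 1,
          ((2 * r).choose k : ℝ) * (x ^ (2 * r - k) * y ^ k) := by
      rw [add_comm x y, add_pow, ← Finset.add_sum_erase _ _ hmem]
      have : ∀ k, y ^ k * x ^ (2 * r - k) * ((2 * r).choose k : ℝ) =
        ((2 * r).choose k : ℝ) * (x ^ (2 * r - k) * y ^ k) := fun k => by ring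
      simp_rw [this]
      simp only [Nat.choose_one_right, pow_one]
      push_cast
      ring
    rw [e1, e2, ← Finset.add_sum_erase _ _ hmem]
    simp only [pow_one, h0, mul_zero, zero_add]
    refine Finset.sum_le_sum fun k hk => mul_le_mul_of_nonneg_left ?_ (by positivity)
    have hk' : k ≤ 2 * r := by
      have := Finset.mem_of_mem_erase hk
      simp at this; omega
    exact (le_abs_self _).trans
      (abs_integral_pow_mul_pow_le (hf _) (hg _) (by omega) (by omega))
  rw [pow_mul] at key
  exact le_of_pow_le_pow_left₀ (by omega) (by positivity) key

end Moments

end AllMoments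

/-! ### Moment bounds for linear and quadratic forms in independent variables. -/

/-- Independent centred random variables of unit variance with all moments. -/
structure IsStandardFamily {Ω ι : Type*} [MeasurableSpace Ω] (P : Measure Ω)
    (X : ι → Ω → ℝ) : Prop where
  measurable : ∀ a, Measurable (X a)
  indep : iIndepFun X P
  mean_zero : ∀ a, ∫ ω, X a ω ∂P = 0
  sq_one : ∀ a, ∫ ω, X a ω ^ 2 ∂P = 1
  moments : ∀ a, HasAllMoments P (X a)

section Chaos

variable {Ω ι : Type*} [MeasurableSpace Ω] {P : Measure Ω} {X : ι → Ω → ℝ}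

/-- The linear form `∑_{a ∈ F} c a x a`. -/
def linForm (c : ι → ℝ) (F : Finset ι) (x : ι → ℝ) : ℝ := ∑ a ∈ F, c a * x a

/-- The quadratic form `∑_{a, b ∈ F} B a b x a x b`, centred at its mean for standard `x`. -/
def quadForm (B : ι → ι → ℝ) (F : Finset ι) (x : ι → ℝ) : ℝ :=
  ∑ a ∈ F, ∑ b ∈ F, B a b * (x a * x b) - ∑ a ∈ F, B a a

lemma IsStandardFamily.precomp {κ : Type*} (hX : IsStandardFamily P X) {g : κ → ι}
    (hg : Function.Injective g) : IsStandardFamily P (fun k => X (g k)) :=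
  ⟨fun _ => hX.measurable _, hX.indep.precomp hg, fun _ => hX.mean_zero _, fun _ => hX.sq_one _,
    fun _ => hX.moments _⟩

/-- A member of the family is independent of functions of finitely many other members. -/
lemma IsStandardFamily.indepFun [DecidableEq ι] (hX : IsStandardFamily P X) {a : ι}
    {F : Finset ι} (ha : a ∉ F) (φ : (ι → ℝ) → ℝ) (hφ : Measurable φ)
    (hdep : ∀ x y : ι → ℝ, (∀ b ∈ F, x b = y b) → φ x = φ y) :
    IndepFun (fun ω => φ fun b => X b ω) (X a) P := by
  have h := hX.indep.indepFun_finset F {a} (by simpa using ha) hX.measurable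
  -- `φ` takes families on all of `ι`, while independence concerns the coordinates in `F`; extension
  -- by `0` is harmless by `hdep`.
  have hext : Measurable fun (u : F → ℝ) (b : ι) => if h : b ∈ F then u ⟨b, h⟩ else 0 := by
    refine measurable_pi_lambda _ fun b => ?_
    by_cases hb : b ∈ F
    · simpa [hb] using measurable_pi_apply _
    · simp [hb]
  have h2 := h.comp (hφ.comp hext)
    (measurable_pi_apply (⟨a, Finset.mem_singleton_self a⟩ : ({a} : Finset ι)))
  have e1 : (φ ∘ fun (u : F → ℝ) (b : ι) => if h : b ∈ F then u ⟨b, h⟩ else 0) ∘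
      (fun ω (i : F) => X i ω) = fun ω => φ fun b => X b ω := by
    ext ω
    exact hdep _ _ fun b hb => by simp [hb]
  rw [e1] at h2
  exact h2

lemma measurable_linForm (c : ι → ℝ) (F : Finset ι) : Measurable (linForm c F) :=
  Finset.measurable_sum _ fun a _ => (measurable_pi_apply a).const_mul _

lemma measurable_quadForm (B : ι → ι → ℝ) (F : Finset ι) : Measurable (quadForm B F) :=
  (Finset.measurable_sum _ fun a _ => Finset.measurable_sum _ fun b _ =>
    ((measurable_pi_apply a).mul (measurable_pi_apply b)).const_mul _).sub_const _

lemma linForm_congr (c : ι → ℝ) (F : Finset ι) (x y : ι → ℝ) (h : ∀ b ∈ F, x b = y b) :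
    linForm c F x = linForm c F y := Finset.sum_congr rfl fun b hb => by rw [h b hb]

lemma quadForm_congr (B : ι → ι → ℝ) (F : Finset ι) (x y : ι → ℝ) (h : ∀ b ∈ F, x b = y b) :
    quadForm B F x = quadForm B F y := by
  unfold quadForm
  congr 1
  exact Finset.sum_congr rfl fun a ha => Finset.sum_congr rfl fun b hb => by rw [h a ha, h b hb]

lemma IsStandardFamily.linForm_moments (hX : IsStandardFamily P X) (c : ι → ℝ) (F : Finset ι) :
    HasAllMoments P (fun ω => linForm c F fun a => X a ω) :=
  HasAllMoments.sum F fun a _ => (hX.moments a).const_mul (c a)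

lemma IsStandardFamily.quadForm_moments [IsFiniteMeasure P] (hX : IsStandardFamily P X)
    (B : ι → ι → ℝ) (F : Finset ι) : HasAllMoments P (fun ω => quadForm B F fun a => X a ω) :=
  (HasAllMoments.sum F fun a _ => HasAllMoments.sum F fun b _ =>
    ((hX.moments a).mul (hX.moments b)).const_mul (B a b)).sub (HasAllMoments.const _)

lemma IsStandardFamily.integral_linForm (hX : IsStandardFamily P X) (c : ι → ℝ) (F : Finset ι) :
    ∫ ω, linForm c F (fun a => X a ω) ∂P = 0 := by
  unfold linForm
  rw [integral_finsetSum _ fun a _ => ((hX.moments a).const_mul (c a)).integrable]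
  exact Finset.sum_eq_zero fun a _ => by rw [integral_const_mul, hX.mean_zero, mul_zero]

lemma linForm_insert [DecidableEq ι] (c : ι → ℝ) {F : Finset ι} {a : ι} (ha : a ∉ F)
    (x : ι → ℝ) : linForm c (insert a F) x = linForm c F x + c a * x a := by
  rw [linForm, Finset.sum_insert ha, add_comm]; rfl

/-- The increment is a martingale difference: when `x` is a standard family, both of its parts have
mean zero given the variables in `F`. -/
lemma quadForm_insert [DecidableEq ι] (B : ι → ι → ℝ) {F : Finset ι} {a : ι} (ha : a ∉ F)
    (x : ι → ℝ) : quadForm B (insert a F) x = quadForm B F x +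
      (linForm (fun b => B a b + B b a) F x * x a + B a a * (x a ^ 2 - 1)) := by
  simp only [quadForm, linForm, Finset.sum_insert ha, Finset.sum_add_distrib, add_mul,
    Finset.sum_mul]
  have h1 : ∀ b, B a b * x b * x a = B a b * (x a * x b) := fun b => by ring
  have h2 : ∀ b, B b a * x b * x a = B b a * (x b * x a) := fun b => by ring
  simp only [h1, h2]
  ring

lemma IsStandardFamily.integral_quadForm [IsProbabilityMeasure P] (hX : IsStandardFamily P X)
    (B : ι → ι → ℝ) (F : Finset ι) : ∫ ω, quadForm B F (fun a => X a ω) ∂P = 0 := by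
  classical
  induction F using Finset.induction_on with
  | empty => simp [quadForm]
  | insert a F ha ih =>
    simp_rw [quadForm_insert B ha]
    have hL := hX.linForm_moments (fun b => B a b + B b a) F
    have hsq := ((hX.moments a).pow 2).sub (HasAllMoments.const (P := P) 1)
    rw [integral_add (hX.quadForm_moments B F).integrable
      ((hL.mul (hX.moments a)).add (hsq.const_mul _)).integrable, ih,
      integral_add (hL.mul (hX.moments a)).integrable (hsq.const_mul _).integrable,
      (hX.indepFun ha _ (measurable_linForm _ F) (linForm_congr _ F)).integral_fun_mul_eq_mul_integral
        hL.aestronglyMeasurable (hX.moments a).aestronglyMeasurable, hX.mean_zero,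
      integral_const_mul, integral_sub ((hX.moments a).pow 2).integrable (integrable_const _),
      hX.sq_one]
    simp

/-- Each new variable is centred and independent of the previous sum, so `lpNorm_add_sq_le` adds at
most `5 r² K² c a ²`. The old term enters with coefficient one, so no constants accumulate. -/
lemma IsStandardFamily.lpNorm_linForm_sq_le [IsProbabilityMeasure P] (hX : IsStandardFamily P X)
    {r : ℕ} (hr : 1 ≤ r) {K : ℝ} (hK : ∀ a, lpNorm (X a) (2 * r : ℕ) P ≤ K)
    (c : ι → ℝ) (F : Finset ι) :
    lpNorm (fun ω => linForm c F fun a => X a ω) (2 * r : ℕ) P ^ 2 ≤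
      5 * r ^ 2 * K ^ 2 * ∑ a ∈ F, c a ^ 2 := by
  classical
  induction F using Finset.induction_on with
  | empty => simp [linForm]
  | insert a F ha ih =>
    simp_rw [linForm_insert c ha]
    have hL := hX.linForm_moments c F
    have hind := hX.indepFun ha (fun x => linForm c F x ^ (2 * r - 1))
      ((measurable_linForm _ F).pow_const _)
      fun x y h => by rw [linForm_congr c F x y h]
    have h0 : ∫ ω, linForm c F (fun b => X b ω) ^ (2 * r - 1) * (c a * X a ω) ∂P = 0 := by
      simp_rw [mul_left_comm _ (c a)]
      rw [integral_const_mul, hind.integral_fun_mul_eq_mul_integral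
        (hL.pow _).aestronglyMeasurable (hX.moments a).aestronglyMeasurable, hX.mean_zero]
      simp
    refine (lpNorm_add_sq_le hL ((hX.moments a).const_mul (c a)) hr h0).trans ?_
    have h1 : lpNorm (fun ω => c a * X a ω) (2 * r : ℕ) P = |c a| * lpNorm (X a) (2 * r : ℕ) P :=
      lpNorm_const_smul (c a) (X a) P
    rw [h1, Finset.sum_insert ha, mul_pow, sq_abs]
    have h2 : lpNorm (X a) (2 * r : ℕ) P ^ 2 ≤ K ^ 2 := pow_le_pow_left₀ lpNorm_nonneg (hK a) 2
    have h3 : 5 * (r : ℝ) ^ 2 * (c a ^ 2 * lpNorm (X a) (2 * r : ℕ) P ^ 2) ≤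
        5 * (r : ℝ) ^ 2 * (c a ^ 2 * K ^ 2) := by gcongr
    linarith

/-- Independence allows factorization at the same exponent; Cauchy–Schwarz, as in `lpNorm_mul_le`,
doubles it. -/
lemma lpNorm_mul_of_indepFun [IsFiniteMeasure P] {f g : Ω → ℝ} (hf : HasAllMoments P f)
    (hg : HasAllMoments P g)
    (h : IndepFun f g P) {r : ℕ} (hr : 1 ≤ r) :
    lpNorm (fun ω => f ω * g ω) (2 * r : ℕ) P =
      lpNorm f (2 * r : ℕ) P * lpNorm g (2 * r : ℕ) P := by
  have h2 : (2 * r) ≠ 0 := by omega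
  refine (pow_left_inj₀ lpNorm_nonneg (mul_nonneg lpNorm_nonneg lpNorm_nonneg) h2).1 ?_
  rw [mul_pow, lpNorm_pow_eq_integral (hf.mul hg).aestronglyMeasurable hr,
    lpNorm_pow_eq_integral hf.aestronglyMeasurable hr,
    lpNorm_pow_eq_integral hg.aestronglyMeasurable hr]
  simp_rw [mul_pow]
  exact (h.comp (measurable_id.pow_const (2 * r))
    (measurable_id.pow_const (2 * r))).integral_fun_mul_eq_mul_integral
    (hf.pow _).aestronglyMeasurable (hg.pow _).aestronglyMeasurable

lemma lpNorm_mul_le {f g : Ω → ℝ} (hf : HasAllMoments P f)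
    (hg : HasAllMoments P g) {r : ℕ} :
    lpNorm (fun ω => f ω * g ω) (2 * r : ℕ) P ≤
      lpNorm f (4 * r : ℕ) P * lpNorm g (4 * r : ℕ) P := by
  have : ENNReal.HolderTriple ((4 * r : ℕ) : ℝ≥0∞) ((4 * r : ℕ) : ℝ≥0∞) ((2 * r : ℕ) : ℝ≥0∞) := by
    constructor
    rw [show 4 * r = 2 * (2 * r) by ring, Nat.cast_mul, ENNReal.mul_inv (by simp) (by simp),
      ← add_mul]
    simp [ENNReal.inv_two_add_inv_two]
  have h : eLpNorm (f • g) (2 * r : ℕ) P ≤ eLpNorm f (4 * r : ℕ) P * eLpNorm g (4 * r : ℕ) P :=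
    eLpNorm_smul_le_mul_eLpNorm hg.aestronglyMeasurable hf.aestronglyMeasurable
  rw [← toReal_eLpNorm (hf.mul hg).aestronglyMeasurable, ← toReal_eLpNorm hf.aestronglyMeasurable,
    ← toReal_eLpNorm hg.aestronglyMeasurable, ← ENNReal.toReal_mul]
  exact ENNReal.toReal_mono (ENNReal.mul_ne_top (hf _).eLpNorm_ne_top (hg _).eLpNorm_ne_top) h

lemma HasAllMoments.lpNorm_mono [IsProbabilityMeasure P] {f : Ω → ℝ} (hf : HasAllMoments P f)
    {s t : ℕ} (h : s ≤ t) : lpNorm f s P ≤ lpNorm f t P := by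
  rw [← toReal_eLpNorm hf.aestronglyMeasurable, ← toReal_eLpNorm hf.aestronglyMeasurable]
  exact ENNReal.toReal_mono (hf _).eLpNorm_ne_top
    (eLpNorm_le_eLpNorm_of_exponent_le (by exact_mod_cast h) (hf 1).1)

/-- Induction on `F` through `quadForm_insert`. The increment has squared norm at most `20 r² K⁴`
times the squares of the new row and column, and `lpNorm_add_sq_le` contributes the further `5 r²`.
The diagonal `X a ² - 1` is what requires moments of order `4 r`; its norm is at most `K² + 1 ≤ 2
K²`. -/
lemma IsStandardFamily.lpNorm_quadForm_sq_le [IsProbabilityMeasure P]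
    (hX : IsStandardFamily P X) {r : ℕ} (hr : 1 ≤ r) {K : ℝ} (hK1 : 1 ≤ K)
    (hK : ∀ a, lpNorm (X a) (4 * r : ℕ) P ≤ K) (B : ι → ι → ℝ) (F : Finset ι) :
    lpNorm (fun ω => quadForm B F fun a => X a ω) (2 * r : ℕ) P ^ 2 ≤
      100 * r ^ 4 * K ^ 4 * ∑ a ∈ F, ∑ b ∈ F, B a b ^ 2 := by
  classical
  have hK2 : ∀ a, lpNorm (X a) (2 * r : ℕ) P ≤ K := fun a =>
    ((hX.moments a).lpNorm_mono (by omega)).trans (hK a)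
  have hr' : (1 : ℝ) ≤ r := by exact_mod_cast hr
  have hp1 : (1 : ℝ≥0∞) ≤ (2 * r : ℕ) := by
    exact_mod_cast (by omega : 1 ≤ 2 * r)
  induction F using Finset.induction_on with
  | empty => simp [quadForm]
  | insert a F ha ih =>
    simp_rw [quadForm_insert B ha]
    set c : ι → ℝ := fun b => B a b + B b a with hc
    have hQ := hX.quadForm_moments B F
    have hL := hX.linForm_moments c F
    have hLX := hL.mul (hX.moments a)
    have hsq := ((hX.moments a).pow 2).sub (HasAllMoments.const (P := P) 1)
    have hsq' := hsq.const_mul (B a a)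
    have hindL := hX.indepFun ha _ (measurable_linForm c F) (linForm_congr c F)
    have hind1 := hX.indepFun ha (fun x => quadForm B F x ^ (2 * r - 1) * linForm c F x)
      (((measurable_quadForm _ F).pow_const _).mul (measurable_linForm c F))
      fun x y h => by rw [quadForm_congr B F x y h, linForm_congr c F x y h]
    have hind2 := (hX.indepFun ha (fun x => quadForm B F x ^ (2 * r - 1))
      ((measurable_quadForm _ F).pow_const _)
      fun x y h => by rw [quadForm_congr B F x y h]).comp measurable_id
        ((measurable_id.pow_const 2).sub_const (1 : ℝ))
    have h0 : ∫ ω, quadForm B F (fun b => X b ω) ^ (2 * r - 1) *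
        (linForm c F (fun b => X b ω) * X a ω + B a a * (X a ω ^ 2 - 1)) ∂P = 0 := by
      have e : ∀ ω, quadForm B F (fun b => X b ω) ^ (2 * r - 1) *
        (linForm c F (fun b => X b ω) * X a ω + B a a * (X a ω ^ 2 - 1)) =
        quadForm B F (fun b => X b ω) ^ (2 * r - 1) * linForm c F (fun b => X b ω) * X a ω +
        B a a * (quadForm B F (fun b => X b ω) ^ (2 * r - 1) * (X a ω ^ 2 - 1)) := fun ω => by ring
      have i2 : ∫ ω, quadForm B F (fun b => X b ω) ^ (2 * r - 1) * (X a ω ^ 2 - 1) ∂P = 0 := by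
        refine (hind2.integral_fun_mul_eq_mul_integral (hQ.pow _).aestronglyMeasurable
          hsq.aestronglyMeasurable).trans ?_
        have : ∫ ω, (X a ω ^ 2 - 1) ∂P = 0 := by
          rw [integral_sub ((hX.moments a).pow 2).integrable (integrable_const _), hX.sq_one]
          simp
        exact mul_eq_zero_of_right _ this
      simp_rw [e]
      rw [integral_add (((hQ.pow _).mul hL).mul (hX.moments a)).integrable
        (((hQ.pow _).mul hsq).const_mul _).integrable, integral_const_mul, i2,
        hind1.integral_fun_mul_eq_mul_integral ((hQ.pow _).mul hL).aestronglyMeasurable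
        (hX.moments a).aestronglyMeasurable, hX.mean_zero]
      simp
    refine (lpNorm_add_sq_le hQ (hLX.add hsq') hr h0).trans ?_
    set N := lpNorm (fun ω => linForm c F fun b => X b ω) (2 * r : ℕ) P with hN
    have hN0 : 0 ≤ N := lpNorm_nonneg
    have hN2 : N ^ 2 ≤ 5 * r ^ 2 * K ^ 2 * ∑ b ∈ F, c b ^ 2 :=
      hX.lpNorm_linForm_sq_le hr hK2 c F
    have hD : lpNorm (fun ω => linForm c F (fun b => X b ω) * X a ω + B a a * (X a ω ^ 2 - 1))
        (2 * r : ℕ) P ≤ N * K + |B a a| * (2 * K ^ 2) := by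
      refine (lpNorm_add_le (hLX _) hp1).trans (add_le_add ?_ ?_)
      · rw [lpNorm_mul_of_indepFun hL (hX.moments a) hindL hr]
        exact mul_le_mul_of_nonneg_left (hK2 a) hN0
      · have h1 : lpNorm (fun ω => B a a * (X a ω ^ 2 - 1)) (2 * r : ℕ) P =
            |B a a| * lpNorm (fun ω => X a ω ^ 2 - 1) (2 * r : ℕ) P :=
          lpNorm_const_smul (B a a) (fun ω => X a ω ^ 2 - 1) P
        rw [h1]
        refine mul_le_mul_of_nonneg_left ?_ (abs_nonneg _)
        refine (lpNorm_sub_le (((hX.moments a).pow 2) _) hp1).trans ?_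
        have h2 : lpNorm (fun _ : Ω => (1 : ℝ)) (2 * r : ℕ) P = 1 := by
          rw [lpNorm_const (by simp; omega) (IsProbabilityMeasure.ne_zero P)]
          simp
        have h3 : lpNorm (fun ω => X a ω ^ 2) (2 * r : ℕ) P ≤ K ^ 2 := by
          simp_rw [sq]
          exact (lpNorm_mul_le (hX.moments a) (hX.moments a)).trans
            (mul_le_mul (hK a) (hK a) lpNorm_nonneg (by linarith))
        rw [h2]
        nlinarith
    have hD2 := pow_le_pow_left₀ lpNorm_nonneg hD 2
    have hc2 : ∑ b ∈ F, c b ^ 2 ≤ 2 * (∑ b ∈ F, B a b ^ 2 + ∑ b ∈ F, B b a ^ 2) := by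
      rw [← Finset.sum_add_distrib, Finset.mul_sum]
      exact Finset.sum_le_sum fun b _ => by rw [hc]; nlinarith [sq_nonneg (B a b - B b a)]
    set T := ∑ b ∈ F, B a b ^ 2 + ∑ b ∈ F, B b a ^ 2 with hT
    have hT0 : 0 ≤ T := add_nonneg (Finset.sum_nonneg fun _ _ => sq_nonneg _)
      (Finset.sum_nonneg fun _ _ => sq_nonneg _)
    have hsum : ∑ a' ∈ insert a F, ∑ b ∈ insert a F, B a' b ^ 2 =
        ∑ a' ∈ F, ∑ b ∈ F, B a' b ^ 2 + (T + B a a ^ 2) := by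
      simp only [Finset.sum_insert ha, Finset.sum_add_distrib, hT]
      ring
    have hfin : (N * K + |B a a| * (2 * K ^ 2)) ^ 2 ≤ 20 * r ^ 2 * K ^ 4 * (T + B a a ^ 2) := by
      have a1 : (N * K + |B a a| * (2 * K ^ 2)) ^ 2 ≤
          2 * (N ^ 2 * K ^ 2) + 8 * K ^ 4 * B a a ^ 2 := by
        have := sq_nonneg (N * K - |B a a| * (2 * K ^ 2))
        have e : (|B a a| * (2 * K ^ 2)) ^ 2 = 4 * K ^ 4 * B a a ^ 2 := by
          rw [mul_pow, sq_abs]; ring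
        linarith [mul_pow N K 2, sub_sq (N * K) (|B a a| * (2 * K ^ 2)),
          add_sq (N * K) (|B a a| * (2 * K ^ 2))]
      have a2 : N ^ 2 * K ^ 2 ≤ (5 * r ^ 2 * K ^ 2 * (2 * T)) * K ^ 2 := by
        refine mul_le_mul_of_nonneg_right (hN2.trans ?_) (sq_nonneg _)
        exact mul_le_mul_of_nonneg_left hc2 (by positivity)
      have a3 : 8 * K ^ 4 * B a a ^ 2 ≤ 20 * r ^ 2 * K ^ 4 * B a a ^ 2 := by
        have : 0 ≤ K ^ 4 * B a a ^ 2 := by positivity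
        have : 8 ≤ 20 * (r : ℝ) ^ 2 := by nlinarith
        nlinarith
      linarith
    have h5 : 5 * (r : ℝ) ^ 2 * lpNorm (fun ω => linForm c F (fun b => X b ω) * X a ω +
        B a a * (X a ω ^ 2 - 1)) (2 * r : ℕ) P ^ 2 ≤
        5 * (r : ℝ) ^ 2 * (20 * r ^ 2 * K ^ 4 * (T + B a a ^ 2)) :=
      mul_le_mul_of_nonneg_left (hD2.trans hfin) (by positivity)
    rw [hsum]
    linarith

end Chaos

/-! ### Sums of hyperbolically decaying weights. -/

/-- The weight `(1 ∨ m) ^ (-κ)`. -/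
noncomputable def decay (κ : ℝ) (m : ℕ) : ℝ := (max 1 (m : ℝ)) ^ (-κ)

lemma one_le_max_one (m : ℕ) : (1 : ℝ) ≤ max 1 (m : ℝ) := le_max_left _ _

lemma decay_nonneg (κ : ℝ) (m : ℕ) : 0 ≤ decay κ m :=
  Real.rpow_nonneg (zero_le_one.trans (one_le_max_one m)) _

lemma decay_zero (κ : ℝ) : decay κ 0 = 1 := by simp [decay]

lemma decay_antitone {κ : ℝ} (hκ : 0 ≤ κ) : Antitone (decay κ) := fun m k h =>
  Real.rpow_le_rpow_of_nonpos (by have := one_le_max_one m; linarith)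
    (max_le_max le_rfl (by exact_mod_cast h)) (by linarith)

lemma decay_mul (κ κ' : ℝ) (m : ℕ) : decay κ m * decay κ' m = decay (κ + κ') m := by
  rw [decay, decay, decay, ← Real.rpow_add (by have := one_le_max_one m; linarith)]
  congr 1; ring

lemma decay_le_of_le {κ κ' : ℝ} (h : κ ≤ κ') (m : ℕ) : decay κ' m ≤ decay κ m :=
  Real.rpow_le_rpow_of_exponent_le (one_le_max_one m) (by linarith)

lemma decay_succ (κ : ℝ) (m : ℕ) : decay κ (m + 1) = ((m : ℝ) + 1) ^ (-κ) := by
  rw [decay, max_eq_right (by push_cast; linarith [(Nat.cast_nonneg m : (0 : ℝ) ≤ m)])]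
  push_cast; rfl

/-- Partial sums of `(1 ∨ m) ^ (-κ)` for `0 < κ < 1`. -/
lemma sum_range_decay_le {κ : ℝ} (h0 : 0 < κ) (h1 : κ < 1) (n : ℕ) :
    ∑ m ∈ Finset.range (n + 1), decay κ m ≤ 1 + (n : ℝ) ^ (1 - κ) / (1 - κ) := by
  have hk : 0 < 1 - κ := by linarith
  induction n with
  | zero => simp [decay_zero, Real.zero_rpow hk.ne']
  | succ n ih =>
    rw [Finset.sum_range_succ]
    refine (add_le_add_left ih _).trans ?_
    rw [decay_succ]
    have hn : (0 : ℝ) < (n : ℝ) + 1 := by positivity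
    -- Bernoulli's inequality for the exponent `1 - κ ∈ (0, 1)` takes the place of comparison with
    -- an integral.
    have hb := rpow_one_add_le_one_add_mul_self (s := -(1 / ((n : ℝ) + 1)))
      (by rw [neg_le_neg_iff, div_le_one hn]; linarith [(Nat.cast_nonneg n : (0 : ℝ) ≤ n)])
      hk.le (by linarith)
    have e1 : (n : ℝ) ^ (1 - κ) =
        ((n : ℝ) + 1) ^ (1 - κ) * (1 + -(1 / ((n : ℝ) + 1))) ^ (1 - κ) := by
      rw [← Real.mul_rpow hn.le]
      · congr 1; field_simp; ring
      · rw [← sub_eq_add_neg, sub_nonneg, div_le_one hn]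
        linarith [(Nat.cast_nonneg n : (0 : ℝ) ≤ n)]
    have e2 : ((n : ℝ) + 1) ^ (1 - κ) = ((n : ℝ) + 1) * ((n : ℝ) + 1) ^ (-κ) := by
      rw [sub_eq_add_neg, Real.rpow_add hn, Real.rpow_one]
    have hpos : 0 ≤ ((n : ℝ) + 1) ^ (1 - κ) := Real.rpow_nonneg hn.le _
    have h3 : (n : ℝ) ^ (1 - κ) ≤ ((n : ℝ) + 1) ^ (1 - κ) - (1 - κ) * ((n : ℝ) + 1) ^ (-κ) := by
      rw [e1]
      refine (mul_le_mul_of_nonneg_left hb hpos).trans (le_of_eq ?_)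
      rw [e2]; field_simp; ring
    have h4 : (n : ℝ) ^ (1 - κ) / (1 - κ) + ((n : ℝ) + 1) ^ (-κ) ≤
        ((n : ℝ) + 1) ^ (1 - κ) / (1 - κ) := by
      rw [div_add' _ _ _ hk.ne', div_le_div_iff_of_pos_right hk]
      linarith
    push_cast
    linarith

/-- The discrete form of comparing with the integral of `y ^ (-κ)` over `[x, x + 1]`; the right side
telescopes. -/
lemma rpow_neg_succ_le {κ : ℝ} (h1 : 1 < κ) {x : ℝ} (hx : 1 ≤ x) :
    (x + 1) ^ (-κ) ≤ (x ^ (1 - κ) - (x + 1) ^ (1 - κ)) / (κ - 1) := by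
  have hk : 0 < κ - 1 := by linarith
  have hx0 : 0 < x := by linarith
  have hx1 : 0 < x + 1 := by linarith
  rw [le_div_iff₀ hk]
  have e1 : x ^ (1 - κ) = (x + 1) ^ (1 - κ) * (x / (x + 1)) ^ (1 - κ) := by
    rw [← Real.mul_rpow hx1.le (by positivity)]
    congr 1; field_simp
  have e2 : (x + 1) ^ (1 - κ) = (x + 1) * (x + 1) ^ (-κ) := by
    rw [sub_eq_add_neg, Real.rpow_add hx1, Real.rpow_one]
  have hb : 1 + (κ - 1) / (x + 1) ≤ (x / (x + 1)) ^ (1 - κ) := by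
    rw [Real.rpow_def_of_pos (by positivity)]
    have h3 := Real.log_le_sub_one_of_pos (show 0 < x / (x + 1) by positivity)
    have h4 := Real.add_one_le_exp (Real.log (x / (x + 1)) * (1 - κ))
    have h5 : x / (x + 1) - 1 = -(1 / (x + 1)) := by field_simp; ring
    rw [h5] at h3
    have h6 : (κ - 1) / (x + 1) = (κ - 1) * (1 / (x + 1)) := by ring
    nlinarith
  have hpos : 0 ≤ (x + 1) ^ (1 - κ) := Real.rpow_nonneg hx1.le _
  have h7 := mul_le_mul_of_nonneg_left hb hpos
  rw [← e1, mul_add, mul_one] at h7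
  have h8 : (x + 1) ^ (1 - κ) * ((κ - 1) / (x + 1)) = (x + 1) ^ (-κ) * (κ - 1) := by
    rw [e2]; field_simp
  linarith

lemma sum_Ico_succ_decay_le {κ : ℝ} (h1 : 1 < κ) {h : ℕ} (hh : 1 ≤ h) (N : ℕ) :
    ∑ m ∈ Finset.Ico (h + 1) (h + 1 + N), decay κ m ≤
      ((h : ℝ) ^ (1 - κ) - ((h : ℝ) + N) ^ (1 - κ)) / (κ - 1) := by
  have hk : 0 < κ - 1 := by linarith
  have hh' : (1 : ℝ) ≤ h := by exact_mod_cast hh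
  induction N with
  | zero => simp
  | succ N ih =>
    rw [← add_assoc, Finset.sum_Ico_succ_top (by omega)]
    have h2 := rpow_neg_succ_le h1 (x := (h : ℝ) + N)
      (by linarith [(Nat.cast_nonneg N : (0 : ℝ) ≤ N)])
    have e : decay κ (h + 1 + N) = ((h : ℝ) + N + 1) ^ (-κ) := by
      rw [show h + 1 + N = h + N + 1 by ring, decay_succ]; push_cast; rfl
    rw [e]
    refine (add_le_add ih h2).trans (le_of_eq ?_)
    push_cast
    rw [← add_assoc]
    ring

/-- Tail sums of `(1 ∨ m) ^ (-κ)` for `κ > 1`. -/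
lemma sum_Ico_decay_le {κ : ℝ} (h1 : 1 < κ) (h N : ℕ) :
    ∑ m ∈ Finset.Ico h N, decay κ m ≤ (2 + 1 / (κ - 1)) * decay (κ - 1) h := by
  have hk : 0 < κ - 1 := by linarith
  have key : ∀ h : ℕ, 1 ≤ h → ∀ N, ∑ m ∈ Finset.Ico h N, decay κ m ≤
      (1 + 1 / (κ - 1)) * decay (κ - 1) h := by
    intro h hh N
    have hh' : (1 : ℝ) ≤ h := by exact_mod_cast hh
    have hsub : Finset.Ico h N ⊆ Finset.Ico h (h + 1 + N) :=
      Finset.Ico_subset_Ico le_rfl (by omega)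
    refine (Finset.sum_le_sum_of_subset_of_nonneg hsub fun _ _ _ => decay_nonneg _ _).trans ?_
    rw [Finset.sum_eq_sum_Ico_succ_bot (by omega)]
    have h2 := sum_Ico_succ_decay_le h1 hh N
    have h3 : decay κ h ≤ decay (κ - 1) h := decay_le_of_le (by linarith) h
    have h4 : ((h : ℝ) ^ (1 - κ) - ((h : ℝ) + N) ^ (1 - κ)) / (κ - 1) ≤
        1 / (κ - 1) * decay (κ - 1) h := by
      rw [decay, max_eq_right hh', neg_sub, one_div, inv_mul_eq_div,
        div_le_div_iff_of_pos_right hk]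
      have : 0 ≤ ((h : ℝ) + N) ^ (1 - κ) := by positivity
      linarith
    linarith
  -- At `h = 0` the term `m = 0` is split off; it adds `1`, which turns the `1` of `key` into the
  -- `2` of the statement.
  rcases Nat.eq_zero_or_pos h with rfl | hh
  · have h2 := key 1 le_rfl (1 + N)
    have hsub : Finset.Ico 0 N ⊆ Finset.Ico 0 (1 + N) :=
      Finset.Ico_subset_Ico le_rfl (by omega)
    refine (Finset.sum_le_sum_of_subset_of_nonneg hsub fun _ _ _ => decay_nonneg _ _).trans ?_
    rw [Finset.sum_eq_sum_Ico_succ_bot (by omega), decay_zero, decay_zero]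
    have h3 : decay (κ - 1) 1 = 1 := by simp [decay]
    rw [h3] at h2
    simp only [zero_add] at *
    linarith
  · refine (key h hh N).trans (mul_le_mul_of_nonneg_right ?_ (decay_nonneg _ _))
    linarith

/-- Autocovariance bound for hyperbolically decaying weights. -/
lemma sum_decay_mul_decay_le {β : ℝ} (h0 : 1 / 2 < β) (h1 : β < 1) (N h : ℕ) :
    ∑ m ∈ Finset.range N, decay β m * decay β (m + h) ≤
      (3 + 1 / (1 - β) + 1 / (2 * β - 1)) * decay (2 * β - 1) h := by
  have hb : 0 < 1 / (1 - β) := one_div_pos.2 (by linarith)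
  have hb' : 0 < 1 / (2 * β - 1) := one_div_pos.2 (by linarith)
  have hanti := decay_antitone (κ := β) (by linarith)
  have hnn := decay_nonneg (2 * β - 1) h
  have hI := sum_Ico_decay_le (κ := 2 * β) (by linarith) h N
  -- The sum is split at `m = h`. Beyond it `hpt` leaves a tail of order `h ^ (1 - 2 β)`; below it
  -- `hpt2` gives `h ^ (-β)` times a partial sum of order `h ^ (1 - β)`.
  have hpt : ∀ m, decay β m * decay β (m + h) ≤ decay (2 * β) m := fun m => by
    rw [two_mul, ← decay_mul]
    exact mul_le_mul_of_nonneg_left (hanti (by omega)) (decay_nonneg _ _)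
  have hpt2 : ∀ m, decay β m * decay β (m + h) ≤ decay β m * decay β h := fun m =>
    mul_le_mul_of_nonneg_left (hanti (by omega)) (decay_nonneg _ _)
  have hfirst : ∑ m ∈ Finset.range h, decay β m * decay β h ≤
      (1 + 1 / (1 - β)) * decay (2 * β - 1) h := by
    rcases Nat.eq_zero_or_pos h with rfl | hh
    · simp only [Finset.range_zero, Finset.sum_empty]
      exact mul_nonneg (by linarith) hnn
    · obtain ⟨k, rfl⟩ : ∃ k, h = k + 1 := ⟨h - 1, by omega⟩
      rw [← Finset.sum_mul]
      have h2 := sum_range_decay_le (κ := β) (by linarith) h1 k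
      have hk1 : (1 : ℝ) ≤ (k : ℝ) + 1 := by linarith [(Nat.cast_nonneg k : (0 : ℝ) ≤ k)]
      have h3 : 1 + (k : ℝ) ^ (1 - β) / (1 - β) ≤
          (1 + 1 / (1 - β)) * ((k : ℝ) + 1) ^ (1 - β) := by
        have a1 : (1 : ℝ) ≤ ((k : ℝ) + 1) ^ (1 - β) := Real.one_le_rpow hk1 (by linarith)
        have a2 : (k : ℝ) ^ (1 - β) ≤ ((k : ℝ) + 1) ^ (1 - β) :=
          Real.rpow_le_rpow (by positivity) (by linarith) (by linarith)
        have a3 : (k : ℝ) ^ (1 - β) / (1 - β) ≤ 1 / (1 - β) * ((k : ℝ) + 1) ^ (1 - β) := by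
          rw [div_eq_mul_one_div, mul_comm]
          exact mul_le_mul_of_nonneg_left a2 hb.le
        linarith
      refine (mul_le_mul_of_nonneg_right (h2.trans h3) (decay_nonneg _ _)).trans (le_of_eq ?_)
      rw [decay_succ, decay_succ, mul_assoc, ← Real.rpow_add (by linarith)]
      congr 2; ring
  have hsub : Finset.range N ⊆ Finset.range h ∪ Finset.Ico h N := by
    intro m hm
    simp only [Finset.mem_range, Finset.mem_union, Finset.mem_Ico] at *
    omega
  have hdisj : Disjoint (Finset.range h) (Finset.Ico h N) := by
    rw [Finset.disjoint_left]
    intro m hm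
    simp only [Finset.mem_range, Finset.mem_Ico] at *
    omega
  refine (Finset.sum_le_sum_of_subset_of_nonneg hsub fun m _ _ =>
    mul_nonneg (decay_nonneg _ _) (decay_nonneg _ _)).trans ?_
  rw [Finset.sum_union hdisj]
  have s1 := Finset.sum_le_sum (s := Finset.range h) fun m _ => hpt2 m
  have s2 := Finset.sum_le_sum (s := Finset.Ico h N) fun m _ => hpt m
  linarith

/-- The harmonic case `κ = 1` would produce a logarithm. The quadratic forms use `κ = 2 (2 β - 1)`,
for which this case is `β = 3/4`. -/
lemma exists_sum_range_decay_le {κ : ℝ} (h0 : 0 < κ) (h1 : κ ≠ 1) :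
    ∃ C : ℝ, 0 < C ∧ ∀ n : ℕ, 0 < n →
      ∑ m ∈ Finset.range n, decay κ m ≤ C * (n : ℝ) ^ (1 - min κ 1) := by
  rcases lt_or_gt_of_ne h1 with h | h
  · have hb : 0 < 1 / (1 - κ) := one_div_pos.2 (by linarith)
    refine ⟨1 + 1 / (1 - κ), by linarith, fun n hn => ?_⟩
    obtain ⟨k, rfl⟩ : ∃ k, n = k + 1 := ⟨n - 1, by omega⟩
    rw [min_eq_left h.le]
    refine (sum_range_decay_le h0 h k).trans ?_
    have hk1 : (1 : ℝ) ≤ (k : ℝ) + 1 := by linarith [(Nat.cast_nonneg k : (0 : ℝ) ≤ k)]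
    have a1 : (1 : ℝ) ≤ ((k : ℝ) + 1) ^ (1 - κ) := Real.one_le_rpow hk1 (by linarith)
    have a2 : (k : ℝ) ^ (1 - κ) ≤ ((k : ℝ) + 1) ^ (1 - κ) :=
      Real.rpow_le_rpow (by positivity) (by linarith) (by linarith)
    have a3 : (k : ℝ) ^ (1 - κ) / (1 - κ) ≤ 1 / (1 - κ) * ((k : ℝ) + 1) ^ (1 - κ) := by
      rw [div_eq_mul_one_div, mul_comm]
      exact mul_le_mul_of_nonneg_left a2 hb.le
    push_cast
    linarith
  · have hb : 0 < 1 / (κ - 1) := one_div_pos.2 (by linarith)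
    refine ⟨2 + 1 / (κ - 1), by linarith, fun n hn => ?_⟩
    have := sum_Ico_decay_le h 0 n
    rw [min_eq_right h.le, sub_self, Real.rpow_zero]
    rwa [decay_zero, ← Finset.range_eq_Ico] at this

/-- Double sums of `(1 ∨ |i - i'|) ^ (-κ)`. -/
lemma exists_double_sum_decay_le {κ : ℝ} (h0 : 0 < κ) (h1 : κ ≠ 1) :
    ∃ C : ℝ, 0 < C ∧ ∀ n : ℕ, 0 < n →
      ∑ i ∈ Finset.Icc (1 : ℤ) n, ∑ i' ∈ Finset.Icc (1 : ℤ) n, decay κ (i - i').natAbs ≤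
        C * (n : ℝ) ^ (2 - min κ 1) := by
  obtain ⟨C, hC, hsum⟩ := exists_sum_range_decay_le h0 h1
  refine ⟨2 * C, by linarith, fun n hn => ?_⟩
  have hrow : ∀ i ∈ Finset.Icc (1 : ℤ) n, ∑ i' ∈ Finset.Icc (1 : ℤ) n, decay κ (i - i').natAbs ≤
      2 * ∑ m ∈ Finset.range n, decay κ m := by
    intro i hi
    rw [Finset.mem_Icc] at hi
    -- On each side of `i` the distance to `i` is injective and takes values below `n`; the two
    -- sides give the factor `2`.
    have half : ∀ T : Finset ℤ, T ⊆ Finset.Icc (1 : ℤ) n →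
        Set.InjOn (fun i' : ℤ => (i - i').natAbs) T →
        ∑ i' ∈ T, decay κ (i - i').natAbs ≤ ∑ m ∈ Finset.range n, decay κ m := by
      intro T hT hinj
      rw [← Finset.sum_image (f := decay κ) hinj]
      refine Finset.sum_le_sum_of_subset_of_nonneg ?_ fun _ _ _ => decay_nonneg _ _
      intro m hm
      obtain ⟨i', hi', rfl⟩ := Finset.mem_image.1 hm
      have := Finset.mem_Icc.1 (hT hi')
      rw [Finset.mem_range]
      omega
    rw [← Finset.sum_filter_add_sum_filter_not (Finset.Icc (1 : ℤ) n) (fun i' => i' ≤ i), two_mul]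
    refine add_le_add (half _ (Finset.filter_subset _ _) ?_) (half _ (Finset.filter_subset _ _) ?_)
    · intro a ha b hb hab
      simp only [Finset.coe_filter, Set.mem_ofPred_eq] at *
      omega
    · intro a ha b hb hab
      simp only [Finset.coe_filter, Set.mem_ofPred_eq] at *
      omega
  refine (Finset.sum_le_sum hrow).trans ?_
  rw [Finset.sum_const, Int.card_Icc]
  have hn' : (0 : ℝ) < n := by exact_mod_cast hn
  have e : (n : ℝ) ^ (2 - min κ 1) = n * (n : ℝ) ^ (1 - min κ 1) := by
    rw [show 2 - min κ 1 = 1 + (1 - min κ 1) by ring, Real.rpow_add hn', Real.rpow_one]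
  rw [e, nsmul_eq_mul]
  have e2 : (((n : ℤ) + 1 - 1).toNat : ℝ) = n := by simp
  rw [e2]
  have := mul_le_mul_of_nonneg_left (hsum n hn) hn'.le
  linarith

/-! ### Frobenius norms through autocovariances. -/

section Gram

variable {ι : Type*}

/-- The squared Frobenius norm of a sum of rank-one matrices depends only on the two Gram matrices,
so only autocovariances have to be estimated. -/
lemma sum_sum_sq_avg_eq (u v : ℤ → ι → ℝ) (F : Finset ι) (T : Finset ℤ) (c : ℝ) :
    ∑ a ∈ F, ∑ b ∈ F, (c * ∑ i ∈ T, u i a * v i b) ^ 2 =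
      c ^ 2 * ∑ i ∈ T, ∑ i' ∈ T, (∑ a ∈ F, u i a * u i' a) * ∑ b ∈ F, v i b * v i' b := by
  simp_rw [mul_pow, sq (∑ i ∈ T, _), Finset.sum_mul_sum, ← Finset.mul_sum (a := c ^ 2)]
  congr 1
  calc ∑ a ∈ F, ∑ b ∈ F, ∑ i ∈ T, ∑ i' ∈ T, u i a * v i b * (u i' a * v i' b)
      = ∑ a ∈ F, ∑ i ∈ T, ∑ b ∈ F, ∑ i' ∈ T, u i a * v i b * (u i' a * v i' b) :=
        Finset.sum_congr rfl fun a _ => Finset.sum_comm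
    _ = ∑ i ∈ T, ∑ a ∈ F, ∑ b ∈ F, ∑ i' ∈ T, u i a * v i b * (u i' a * v i' b) :=
        Finset.sum_comm
    _ = ∑ i ∈ T, ∑ a ∈ F, ∑ i' ∈ T, ∑ b ∈ F, u i a * v i b * (u i' a * v i' b) :=
        Finset.sum_congr rfl fun i _ => Finset.sum_congr rfl fun a _ => Finset.sum_comm
    _ = ∑ i ∈ T, ∑ i' ∈ T, ∑ a ∈ F, ∑ b ∈ F, u i a * v i b * (u i' a * v i' b) :=
        Finset.sum_congr rfl fun i _ => Finset.sum_comm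
    _ = _ := Finset.sum_congr rfl fun i _ => Finset.sum_congr rfl fun i' _ =>
        Finset.sum_congr rfl fun a _ => Finset.sum_congr rfl fun b _ => by ring

lemma sum_sq_avg_eq (u : ℤ → ι → ℝ) (F : Finset ι) (T : Finset ℤ) (c : ℝ) :
    ∑ a ∈ F, (c * ∑ i ∈ T, u i a) ^ 2 =
      c ^ 2 * ∑ i ∈ T, ∑ i' ∈ T, ∑ a ∈ F, u i a * u i' a := by
  simp_rw [mul_pow, sq (∑ i ∈ T, _), Finset.sum_mul_sum, ← Finset.mul_sum (a := c ^ 2)]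
  congr 1
  rw [Finset.sum_comm]
  exact Finset.sum_congr rfl fun i _ => Finset.sum_comm

/-- The family `u` has autocovariances of size at most `Γ (1 ∨ |i - i'|) ^ (-κ)` over `1, …, n`. -/
def HasGramDecay (u : ℤ → ι → ℝ) (F : Finset ι) (n : ℕ) (Γ κ : ℝ) : Prop :=
  ∀ i ∈ Finset.Icc (1 : ℤ) n, ∀ i' ∈ Finset.Icc (1 : ℤ) n,
    |∑ a ∈ F, u i a * u i' a| ≤ Γ * decay κ (i - i').natAbs

lemma inv_sq_mul_rpow {n : ℕ} (hn : 0 < n) (s : ℝ) :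
    ((n : ℝ)⁻¹) ^ 2 * (n : ℝ) ^ (2 - s) = (n : ℝ) ^ (-s) := by
  have hn' : (0 : ℝ) < n := by exact_mod_cast hn
  rw [sub_eq_add_neg, Real.rpow_add hn', ← mul_assoc, Real.rpow_two]
  field_simp

lemma sum_sum_sq_avg_le {u v : ℤ → ι → ℝ} {F : Finset ι} {n : ℕ} (hn : 0 < n) {Γ κ C s : ℝ}
    (hu : HasGramDecay u F n Γ κ) (hv : HasGramDecay v F n Γ κ)
    (hC : ∑ i ∈ Finset.Icc (1 : ℤ) n, ∑ i' ∈ Finset.Icc (1 : ℤ) n, decay (2 * κ) (i - i').natAbs ≤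
      C * (n : ℝ) ^ (2 - s)) :
    ∑ a ∈ F, ∑ b ∈ F, ((n : ℝ)⁻¹ * ∑ i ∈ Finset.Icc (1 : ℤ) n, u i a * v i b) ^ 2 ≤
      Γ ^ 2 * C * (n : ℝ) ^ (-s) := by
  rw [sum_sum_sq_avg_eq, ← inv_sq_mul_rpow hn]
  have h : ∑ i ∈ Finset.Icc (1 : ℤ) n, ∑ i' ∈ Finset.Icc (1 : ℤ) n,
      (∑ a ∈ F, u i a * u i' a) * ∑ b ∈ F, v i b * v i' b ≤
      Γ ^ 2 * ∑ i ∈ Finset.Icc (1 : ℤ) n, ∑ i' ∈ Finset.Icc (1 : ℤ) n,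
        decay (2 * κ) (i - i').natAbs := by
    simp_rw [Finset.mul_sum (a := Γ ^ 2)]
    refine Finset.sum_le_sum fun i hi => Finset.sum_le_sum fun i' hi' => ?_
    refine (le_abs_self _).trans ?_
    rw [abs_mul, two_mul, ← decay_mul]
    refine (mul_le_mul (hu i hi i' hi') (hv i hi i' hi') (abs_nonneg _)
      ((abs_nonneg _).trans (hu i hi i' hi'))).trans (le_of_eq (by ring))
  have h2 := h.trans (mul_le_mul_of_nonneg_left hC (sq_nonneg Γ))
  refine (mul_le_mul_of_nonneg_left h2 (sq_nonneg _)).trans (le_of_eq (by ring))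

lemma sum_sq_avg_le {u : ℤ → ι → ℝ} {F : Finset ι} {n : ℕ} (hn : 0 < n) {Γ κ C s : ℝ}
    (hΓ : 0 ≤ Γ) (hu : HasGramDecay u F n Γ κ)
    (hC : ∑ i ∈ Finset.Icc (1 : ℤ) n, ∑ i' ∈ Finset.Icc (1 : ℤ) n, decay κ (i - i').natAbs ≤
      C * (n : ℝ) ^ (2 - s)) :
    ∑ a ∈ F, ((n : ℝ)⁻¹ * ∑ i ∈ Finset.Icc (1 : ℤ) n, u i a) ^ 2 ≤
      Γ * C * (n : ℝ) ^ (-s) := by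
  rw [sum_sq_avg_eq, ← inv_sq_mul_rpow hn]
  have h : ∑ i ∈ Finset.Icc (1 : ℤ) n, ∑ i' ∈ Finset.Icc (1 : ℤ) n,
      ∑ a ∈ F, u i a * u i' a ≤
      Γ * ∑ i ∈ Finset.Icc (1 : ℤ) n, ∑ i' ∈ Finset.Icc (1 : ℤ) n,
        decay κ (i - i').natAbs := by
    simp_rw [Finset.mul_sum (a := Γ)]
    exact Finset.sum_le_sum fun i hi => Finset.sum_le_sum fun i' hi' =>
      (le_abs_self _).trans (hu i hi i' hi')
  have h2 := h.trans (mul_le_mul_of_nonneg_left hC hΓ)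
  refine (mul_le_mul_of_nonneg_left h2 (sq_nonneg _)).trans (le_of_eq (by ring))

end Gram

/-! ### The truncated process as linear and quadratic forms in the innovations. -/

section Lags

variable {p : ℕ}

/-- The coefficient of the innovation with index `a` in the sum of the first `N` lags of the
`j`-th coordinate at time `i`. -/
noncomputable def lagCoef (A : ℕ → Matrix (Fin p) (Fin p) ℝ) (N : ℕ) (j : Fin p) (i : ℤ)
    (a : ℤ × Fin p) : ℝ :=
  if 0 ≤ i - a.1 ∧ i - a.1 < N then A (i - a.1).toNat j a.2 else 0

/-- The sum of the first `N` lags of the centred linear process. -/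
noncomputable def lagSum (A : ℕ → Matrix (Fin p) (Fin p) ℝ) (N : ℕ) (j : Fin p) (i : ℤ)
    (x : ℤ × Fin p → ℝ) : ℝ :=
  ∑ m ∈ Finset.range N, ∑ l, A m j l * x (i - m, l)

/-- The covariance matrix of the sum of the first `N` lags. -/
noncomputable def lagCov (A : ℕ → Matrix (Fin p) (Fin p) ℝ) (N : ℕ) (j k : Fin p) : ℝ :=
  ∑ m ∈ Finset.range N, ∑ l, A m j l * A m k l

/-- The innovations entering the first `N` lags at times `1, …, n`. -/
noncomputable def lagWindow (p n N : ℕ) : Finset (ℤ × Fin p) :=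
  Finset.Icc (1 - N : ℤ) n ×ˢ Finset.univ

/-- The substitution `m = i - s` passes from one window common to all times to the lags of a single
time. -/
lemma sum_lag {n N : ℕ} {i : ℤ} (hi : i ∈ Finset.Icc (1 : ℤ) n) (h : ℕ → ℝ) :
    ∑ s ∈ Finset.Icc (1 - N : ℤ) n, (if 0 ≤ i - s ∧ i - s < N then h (i - s).toNat else 0) =
      ∑ m ∈ Finset.range N, h m := by
  rw [Finset.mem_Icc] at hi
  rw [← Finset.sum_filter]
  refine Finset.sum_nbij' (fun s => (i - s).toNat) (fun m => i - m) ?_ ?_ ?_ ?_ ?_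
  · intro s hs
    simp only [Finset.mem_filter, Finset.mem_Icc, Finset.mem_range] at *
    omega
  · intro m hm
    simp only [Finset.mem_filter, Finset.mem_Icc, Finset.mem_range] at *
    omega
  · intro s hs
    simp only [Finset.mem_filter, Finset.mem_Icc] at *
    omega
  · intro m hm
    simp
  · intro s hs
    rfl

lemma lagSum_eq_linForm (A : ℕ → Matrix (Fin p) (Fin p) ℝ) (N : ℕ) (j : Fin p) {n : ℕ} {i : ℤ}
    (hi : i ∈ Finset.Icc (1 : ℤ) n) (x : ℤ × Fin p → ℝ) :
    lagSum A N j i x = linForm (lagCoef A N j i) (lagWindow p n N) x := by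
  rw [lagSum, linForm, lagWindow, Finset.sum_product,
    ← sum_lag hi fun m => ∑ l, A m j l * x (i - m, l)]
  refine Finset.sum_congr rfl fun s _ => ?_
  by_cases h : 0 ≤ i - s ∧ i - s < N
  · have : i - ((i - s).toNat : ℤ) = s := by omega
    simp only [lagCoef, if_pos h, this]
  · simp only [lagCoef, if_neg h, zero_mul, Finset.sum_const_zero]

lemma sum_lagCoef_mul_lagCoef (A : ℕ → Matrix (Fin p) (Fin p) ℝ) (N : ℕ) (j k : Fin p) {n : ℕ}
    {i : ℤ} (hi : i ∈ Finset.Icc (1 : ℤ) n) :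
    ∑ a ∈ lagWindow p n N, lagCoef A N j i a * lagCoef A N k i a = lagCov A N j k := by
  rw [lagCov, lagWindow, Finset.sum_product, ← sum_lag hi fun m => ∑ l, A m j l * A m k l]
  refine Finset.sum_congr rfl fun s _ => ?_
  by_cases h : 0 ≤ i - s ∧ i - s < N
  · simp only [lagCoef, if_pos h]
  · simp only [lagCoef, if_neg h, zero_mul, Finset.sum_const_zero]

lemma abs_sum_row_mul_le {A : ℕ → Matrix (Fin p) (Fin p) ℝ} {β C₀ : ℝ}
    (hA : DecayCondition A β C₀) (m m' : ℕ) (j k : Fin p) :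
    |∑ l, A m j l * A m' k l| ≤ C₀ ^ 2 * (decay β m * decay β m') := by
  have h1 := hA m j
  have h2 := hA m' k
  have h3 : |∑ l, A m j l * A m' k l| ≤ √(∑ l, A m j l ^ 2) * √(∑ l, A m' k l ^ 2) := by
    rw [← Real.sqrt_mul (Finset.sum_nonneg fun _ _ => sq_nonneg _)]
    exact Real.abs_le_sqrt (Finset.sum_mul_sq_le_sq_mul_sq _ _ _)
  refine h3.trans ((mul_le_mul h1 h2 (Real.sqrt_nonneg _)
    ((Real.sqrt_nonneg _).trans h1)).trans (le_of_eq ?_))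
  rw [decay, decay]; ring

/-- For `i ≤ i'`, an innovation with lag `m` at time `i` has lag `m + (i' - i)` at time `i'`.
Cauchy–Schwarz on the rows reduces the claim to `sum_decay_mul_decay_le`, with a constant free of
`N`. -/
lemma hasGramDecay_lagCoef {A : ℕ → Matrix (Fin p) (Fin p) ℝ} {β C₀ : ℝ}
    (hA : DecayCondition A β C₀) (h0 : 1 / 2 < β) (h1 : β < 1) (N : ℕ) (j : Fin p) (n : ℕ) :
    HasGramDecay (lagCoef A N j) (lagWindow p n N) n
      (C₀ ^ 2 * (3 + 1 / (1 - β) + 1 / (2 * β - 1))) (2 * β - 1) := by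
  have key : ∀ i ∈ Finset.Icc (1 : ℤ) n, ∀ i' ∈ Finset.Icc (1 : ℤ) n, i ≤ i' →
      |∑ a ∈ lagWindow p n N, lagCoef A N j i a * lagCoef A N j i' a| ≤
        C₀ ^ 2 * (3 + 1 / (1 - β) + 1 / (2 * β - 1)) * decay (2 * β - 1) (i' - i).natAbs := by
    intro i hi i' hi' hle
    rw [lagWindow, Finset.sum_product]
    have hb : ∀ s ∈ Finset.Icc (1 - N : ℤ) n,
        |∑ l, lagCoef A N j i (s, l) * lagCoef A N j i' (s, l)| ≤
        if 0 ≤ i - s ∧ i - s < N then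
          C₀ ^ 2 * (decay β (i - s).toNat * decay β ((i - s).toNat + (i' - i).natAbs)) else 0 := by
      intro s _
      by_cases h : 0 ≤ i - s ∧ i - s < N
      · rw [if_pos h]
        by_cases h' : 0 ≤ i' - s ∧ i' - s < N
        · have e : (i' - s).toNat = (i - s).toNat + (i' - i).natAbs := by omega
          simp only [lagCoef, if_pos h, if_pos h']
          rw [← e]
          exact abs_sum_row_mul_le hA _ _ _ _
        · simp only [lagCoef, if_neg h', mul_zero, Finset.sum_const_zero, abs_zero]
          exact mul_nonneg (sq_nonneg _) (mul_nonneg (decay_nonneg _ _) (decay_nonneg _ _))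
      · simp only [lagCoef, if_neg h, zero_mul, Finset.sum_const_zero, abs_zero, le_refl]
    refine (Finset.abs_sum_le_sum_abs _ _).trans ((Finset.sum_le_sum hb).trans ?_)
    rw [sum_lag hi fun m => C₀ ^ 2 * (decay β m * decay β (m + (i' - i).natAbs)),
      ← Finset.mul_sum, mul_assoc]
    exact mul_le_mul_of_nonneg_left (sum_decay_mul_decay_le h0 h1 N _) (sq_nonneg _)
  intro i hi i' hi'
  rcases le_total i i' with h | h
  · rw [← Int.natAbs_neg, neg_sub]
    exact key i hi i' hi' h
  · simp_rw [mul_comm (lagCoef A N j i _)]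
    exact key i' hi' i hi h

/-- The sample covariance of the first `N` lags (known mean) is a centred quadratic form. -/
lemma avg_lagSum_mul_sub_lagCov (A : ℕ → Matrix (Fin p) (Fin p) ℝ) (N : ℕ) (j k : Fin p) {n : ℕ}
    (hn : 0 < n) (x : ℤ × Fin p → ℝ) :
    (n : ℝ)⁻¹ * ∑ i ∈ Finset.Icc (1 : ℤ) n, lagSum A N j i x * lagSum A N k i x -
        lagCov A N j k =
      quadForm (fun a b => (n : ℝ)⁻¹ * ∑ i ∈ Finset.Icc (1 : ℤ) n,
        lagCoef A N j i a * lagCoef A N k i b) (lagWindow p n N) x := by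
  have hn' : (n : ℝ) ≠ 0 := by exact_mod_cast hn.ne'
  rw [quadForm]
  congr 1
  · have h : ∀ i ∈ Finset.Icc (1 : ℤ) n, lagSum A N j i x * lagSum A N k i x =
        ∑ a ∈ lagWindow p n N, ∑ b ∈ lagWindow p n N,
          lagCoef A N j i a * lagCoef A N k i b * (x a * x b) := fun i hi => by
      rw [lagSum_eq_linForm A N j hi, lagSum_eq_linForm A N k hi, linForm, linForm,
        Finset.sum_mul_sum]
      exact Finset.sum_congr rfl fun a _ => Finset.sum_congr rfl fun b _ => by ring
    rw [Finset.sum_congr rfl h, Finset.sum_comm]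
    simp_rw [mul_assoc (n : ℝ)⁻¹, ← Finset.mul_sum (a := (n : ℝ)⁻¹), Finset.sum_mul]
    congr 1
    exact Finset.sum_congr rfl fun a _ => Finset.sum_comm
  · rw [← Finset.mul_sum, Finset.sum_comm,
      Finset.sum_congr rfl fun i hi => sum_lagCoef_mul_lagCoef A N j k hi, Finset.sum_const,
      Int.card_Icc, nsmul_eq_mul]
    have : (((n : ℤ) + 1 - 1).toNat : ℝ) = n := by simp
    rw [this]
    field_simp

lemma avg_lagSum (A : ℕ → Matrix (Fin p) (Fin p) ℝ) (N : ℕ) (j : Fin p) {n : ℕ}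
    (x : ℤ × Fin p → ℝ) :
    (n : ℝ)⁻¹ * ∑ i ∈ Finset.Icc (1 : ℤ) n, lagSum A N j i x =
      linForm (fun a => (n : ℝ)⁻¹ * ∑ i ∈ Finset.Icc (1 : ℤ) n, lagCoef A N j i a)
        (lagWindow p n N) x := by
  rw [Finset.sum_congr rfl fun i hi => lagSum_eq_linForm A N j hi x]
  simp only [linForm]
  rw [Finset.sum_comm]
  simp_rw [mul_assoc, ← Finset.mul_sum (a := (n : ℝ)⁻¹), Finset.sum_mul]

end Lags

/-- Moment bounds for the sample covariance of the first `N` lags. -/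
lemma exists_lpNorm_lag_le {β C₀ : ℝ} (h0 : 1 / 2 < β) (h1 : β < 1) (h34 : β ≠ 3 / 4) :
    ∃ M : ℝ, 0 < M ∧ ∀ (p n : ℕ) (_ : 0 < n) {Ω : Type*} [MeasurableSpace Ω] {P : Measure Ω}
      [IsProbabilityMeasure P] {X : ℤ × Fin p → Ω → ℝ} (_ : IsStandardFamily P X)
      {A : ℕ → Matrix (Fin p) (Fin p) ℝ} (_ : DecayCondition A β C₀) {r : ℕ} (_ : 1 ≤ r) {K : ℝ}
      (_ : 1 ≤ K) (_ : ∀ a, lpNorm (X a) (4 * r : ℕ) P ≤ K) (N : ℕ) (j k : Fin p),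
      lpNorm (fun ω => (n : ℝ)⁻¹ * ∑ i ∈ Finset.Icc (1 : ℤ) n,
          lagSum A N j i (fun a => X a ω) * lagSum A N k i (fun a => X a ω) - lagCov A N j k)
        (2 * r : ℕ) P ≤ M * r ^ 2 * K ^ 2 * (n : ℝ) ^ (-(min (2 * β - 1) (1 / 2))) ∧
      lpNorm (fun ω => ((n : ℝ)⁻¹ * ∑ i ∈ Finset.Icc (1 : ℤ) n, lagSum A N j i (fun a => X a ω)) *
          ((n : ℝ)⁻¹ * ∑ i ∈ Finset.Icc (1 : ℤ) n, lagSum A N k i (fun a => X a ω)))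
        (2 * r : ℕ) P ≤ M * r ^ 2 * K ^ 2 * (n : ℝ) ^ (-(min (2 * β - 1) (1 / 2))) := by
  obtain ⟨C, hC, hsum⟩ := exists_double_sum_decay_le (κ := 2 * (2 * β - 1)) (by linarith)
    (fun h => h34 (by linarith))
  obtain ⟨C', hC', hsum'⟩ := exists_double_sum_decay_le (κ := 2 * β - 1) (by linarith)
    (by linarith : (2 * β - 1) < 1).ne
  have hb : 0 < 1 / (1 - β) := one_div_pos.2 (by linarith)
  have hb' : 0 < 1 / (2 * β - 1) := one_div_pos.2 (by linarith)
  set Γ := C₀ ^ 2 * (3 + 1 / (1 - β) + 1 / (2 * β - 1)) with hΓ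
  have hΓ0 : 0 ≤ Γ := mul_nonneg (sq_nonneg _) (by linarith)
  -- The first summand is the root of `100 Γ² C` for quadratic forms; the second comes from `5 (2
  -- r)²` for linear forms in `L^{4r}`; the `1` keeps the constant positive when `C₀ = 0`.
  refine ⟨10 * (Γ * √C) + 20 * (Γ * C') + 1, by positivity, ?_⟩
  intro p n hn Ω _ P _ X hX A hA r hr K hK1 hK N j k
  have hn1 : (1 : ℝ) ≤ n := by exact_mod_cast hn
  have hG : ∀ j, HasGramDecay (lagCoef A N j) (lagWindow p n N) n Γ (2 * β - 1) := fun j =>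
    hasGramDecay_lagCoef hA h0 h1 N j n
  set ρ := (n : ℝ) ^ (-(min (2 * β - 1) (1 / 2))) with hρ
  have hρ0 : 0 ≤ ρ := by positivity
  have hbase : 0 ≤ (r : ℝ) ^ 2 * K ^ 2 * ρ := by positivity
  constructor
  · simp_rw [avg_lagSum_mul_sub_lagCov A N j k hn]
    -- The exponent for the squared norm is twice `min (2 β - 1) (1 / 2)`, so taking the root gives
    -- `ρ`.
    have hρ2 : (n : ℝ) ^ (-(min (2 * (2 * β - 1)) 1)) = ρ ^ 2 := by
      rw [hρ, ← Real.rpow_natCast, ← Real.rpow_mul (by positivity)]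
      congr 1
      rw [show (1 : ℝ) = 2 * (1 / 2) by norm_num, ← mul_min_of_nonneg _ _ (by norm_num : (0:ℝ) ≤ 2)]
      norm_num
      ring
    have hq := (hX.lpNorm_quadForm_sq_le hr hK1 hK _ (lagWindow p n N)).trans
      (mul_le_mul_of_nonneg_left (sum_sum_sq_avg_le hn (hG j) (hG k) (hsum n hn))
        (by positivity))
    rw [hρ2] at hq
    have : 100 * (r : ℝ) ^ 4 * K ^ 4 * (Γ ^ 2 * C * ρ ^ 2) =
        (10 * (Γ * √C) * (r ^ 2 * K ^ 2 * ρ)) ^ 2 := by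
      have := Real.sq_sqrt hC.le
      calc 100 * (r : ℝ) ^ 4 * K ^ 4 * (Γ ^ 2 * C * ρ ^ 2)
          = 100 * (r : ℝ) ^ 4 * K ^ 4 * (Γ ^ 2 * (√C) ^ 2 * ρ ^ 2) := by rw [this]
        _ = _ := by ring
    rw [this] at hq
    have hq' := le_of_sq_le_sq hq (by positivity)
    refine hq'.trans ?_
    have : 0 ≤ 20 * (Γ * C') + 1 := by positivity
    nlinarith
  · simp_rw [avg_lagSum]
    have hlin : ∀ j, lpNorm (fun ω => linForm (fun a => (n : ℝ)⁻¹ * ∑ i ∈ Finset.Icc (1 : ℤ) n,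
        lagCoef A N j i a) (lagWindow p n N) fun a => X a ω) (4 * r : ℕ) P ^ 2 ≤
        20 * (Γ * C') * (r ^ 2 * K ^ 2 * ρ) := by
      intro j
      have hl := hX.lpNorm_linForm_sq_le (r := 2 * r) (by omega) (K := K)
        (by simpa [← mul_assoc] using hK) (fun a => (n : ℝ)⁻¹ * ∑ i ∈ Finset.Icc (1 : ℤ) n,
        lagCoef A N j i a) (lagWindow p n N)
      have hs := sum_sq_avg_le hn hΓ0 (hG j) (hsum' n hn)
      rw [min_eq_left (by linarith : 2 * β - 1 ≤ 1)] at hs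
      have hle : (n : ℝ) ^ (-(2 * β - 1)) ≤ ρ :=
        Real.rpow_le_rpow_of_exponent_le hn1 (neg_le_neg (min_le_left _ _))
      have hs' := hs.trans (mul_le_mul_of_nonneg_left hle (by positivity : 0 ≤ Γ * C'))
      have := hl.trans (mul_le_mul_of_nonneg_left hs' (by positivity))
      rw [show 2 * (2 * r) = 4 * r by ring] at this
      refine this.trans (le_of_eq ?_)
      push_cast
      ring
    refine (lpNorm_mul_le (hX.linForm_moments _ _) (hX.linForm_moments _ _)).trans ?_
    have h1 := hlin j
    have h2 := hlin k
    have h3 : 0 ≤ 10 * (Γ * √C) + 1 := by positivity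
    have h4 := two_mul_le_add_sq
      (lpNorm (fun ω => linForm (fun a => (n : ℝ)⁻¹ * ∑ i ∈ Finset.Icc (1 : ℤ) n,
        lagCoef A N j i a) (lagWindow p n N) fun a => X a ω) (4 * r : ℕ) P)
      (lpNorm (fun ω => linForm (fun a => (n : ℝ)⁻¹ * ∑ i ∈ Finset.Icc (1 : ℤ) n,
        lagCoef A N k i a) (lagWindow p n N) fun a => X a ω) (4 * r : ℕ) P)
    have h5 := mul_nonneg h3 hbase
    linarith

/-! ### Convergence in `L^q` and the passage to the limit. -/

section Conv

variable {Ω : Type*} [MeasurableSpace Ω] {P : Measure Ω} {q : ℝ≥0∞}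

/-- Convergence in `L^q`. -/
structure ConvLp (P : Measure Ω) (q : ℝ≥0∞) (f : ℕ → Ω → ℝ) (y : Ω → ℝ) : Prop where
  memLp : ∀ N, MemLp (f N) q P
  memLp_lim : MemLp y q P
  tendsto : Tendsto (fun N => eLpNorm (fun ω => f N ω - y ω) q P) atTop (𝓝 0)

variable {f g : ℕ → Ω → ℝ} {y z : Ω → ℝ}

lemma ConvLp.add (hq : 1 ≤ q) (hf : ConvLp P q f y) (hg : ConvLp P q g z) :
    ConvLp P q (fun N ω => f N ω + g N ω) (fun ω => y ω + z ω) := by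
  refine ⟨fun N => (hf.memLp N).add (hg.memLp N), hf.memLp_lim.add hg.memLp_lim, ?_⟩
  refine tendsto_of_tendsto_of_tendsto_of_le_of_le tendsto_const_nhds
    (by simpa using hf.tendsto.add hg.tendsto) (fun _ => zero_le) fun N => ?_
  have h := eLpNorm_add_le ((hf.memLp N).sub hf.memLp_lim).1 ((hg.memLp N).sub hg.memLp_lim).1 hq
  refine le_trans (le_of_eq ?_) h
  congr 1; ext ω; simp only [Pi.add_apply, Pi.sub_apply]; ring

lemma ConvLp.const_mul (hf : ConvLp P q f y) (c : ℝ) :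
    ConvLp P q (fun N ω => c * f N ω) (fun ω => c * y ω) := by
  refine ⟨fun N => (hf.memLp N).const_mul c, hf.memLp_lim.const_mul c, ?_⟩
  have h : ∀ N, eLpNorm (fun ω => c * f N ω - c * y ω) q P =
      ‖c‖ₑ * eLpNorm (fun ω => f N ω - y ω) q P := fun N => by
    rw [← eLpNorm_const_smul]
    congr 1; ext ω; simp only [Pi.smul_apply, smul_eq_mul]; ring
  simp_rw [h]
  simpa using ENNReal.Tendsto.const_mul hf.tendsto (Or.inr (enorm_ne_top (x := c)))

lemma ConvLp.sub (hq : 1 ≤ q) (hf : ConvLp P q f y) (hg : ConvLp P q g z) :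
    ConvLp P q (fun N ω => f N ω - g N ω) (fun ω => y ω - z ω) := by
  simpa [sub_eq_add_neg] using hf.add hq (hg.const_mul (-1))

lemma ConvLp.sum (hq : 1 ≤ q) {ι : Type*} (T : Finset ι) {f : ι → ℕ → Ω → ℝ} {y : ι → Ω → ℝ}
    (hf : ∀ i ∈ T, ConvLp P q (f i) (y i)) :
    ConvLp P q (fun N ω => ∑ i ∈ T, f i N ω) (fun ω => ∑ i ∈ T, y i ω) := by
  classical
  induction T using Finset.induction_on with
  | empty =>
    simp only [Finset.sum_empty]
    exact ⟨fun _ => MemLp.zero', MemLp.zero', by simp⟩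
  | insert a T ha ih =>
    simp only [Finset.sum_insert ha]
    exact (hf a (Finset.mem_insert_self a T)).add hq
      (ih fun i hi => hf i (Finset.mem_insert_of_mem hi))

lemma ConvLp.of_tendsto_const [IsProbabilityMeasure P] (hq : 1 ≤ q) {c : ℕ → ℝ} {c' : ℝ}
    (h : Tendsto c atTop (𝓝 c')) : ConvLp P q (fun N _ => c N) (fun _ => c') := by
  refine ⟨fun N => memLp_const _, memLp_const _, ?_⟩
  have h1 : ∀ N, eLpNorm (fun _ : Ω => c N - c') q P = ‖c N - c'‖ₑ := fun N => by
    rw [eLpNorm_const _ (by positivity) (IsProbabilityMeasure.ne_zero P)]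
    simp
  simp_rw [h1]
  have h2 : Tendsto (fun N => c N - c') atTop (𝓝 0) := by simpa using h.sub_const c'
  simpa using h2.enorm

lemma ConvLp.mul (hf : ConvLp P 2 f y) (hg : ConvLp P 2 g z) :
    ConvLp P 1 (fun N ω => f N ω * g N ω) (fun ω => y ω * z ω) := by
  have hol : ∀ {u v : Ω → ℝ}, MemLp u 2 P → MemLp v 2 P →
      eLpNorm (fun ω => u ω * v ω) 1 P ≤ eLpNorm u 2 P * eLpNorm v 2 P := by
    intro u v hu hv
    have h : eLpNorm (u • v) 1 P ≤ eLpNorm u 2 P * eLpNorm v 2 P :=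
      eLpNorm_smul_le_mul_eLpNorm hv.1 hu.1
    exact h
  refine ⟨fun N => (hg.memLp N).mul' (hf.memLp N), hg.memLp_lim.mul' hf.memLp_lim, ?_⟩
  have hlim : Tendsto (fun N =>
      eLpNorm (fun ω => f N ω - y ω) 2 P * eLpNorm (fun ω => g N ω - z ω) 2 P +
      (eLpNorm y 2 P * eLpNorm (fun ω => g N ω - z ω) 2 P +
        eLpNorm (fun ω => f N ω - y ω) 2 P * eLpNorm z 2 P)) atTop (𝓝 0) := by
    have h1 := ENNReal.Tendsto.mul hf.tendsto (by simp) hg.tendsto (by simp)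
    have h2 := ENNReal.Tendsto.const_mul (a := eLpNorm y 2 P) hg.tendsto
      (Or.inr hf.memLp_lim.eLpNorm_ne_top)
    have h3 := ENNReal.Tendsto.mul_const (b := eLpNorm z 2 P) hf.tendsto
      (Or.inr hg.memLp_lim.eLpNorm_ne_top)
    simpa using h1.add (h2.add h3)
  refine tendsto_of_tendsto_of_tendsto_of_le_of_le tendsto_const_nhds hlim
    (fun _ => zero_le) fun N => ?_
  have a1 := (hf.memLp N).sub hf.memLp_lim
  have a2 := (hg.memLp N).sub hg.memLp_lim
  have b1 : MemLp (fun ω => (f N ω - y ω) * (g N ω - z ω)) 1 P := a2.mul' a1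
  have b2 : MemLp (fun ω => y ω * (g N ω - z ω)) 1 P := a2.mul' hf.memLp_lim
  have b3 : MemLp (fun ω => (f N ω - y ω) * z ω) 1 P := hg.memLp_lim.mul' a1
  have e : (fun ω => f N ω * g N ω - y ω * z ω) =
      (fun ω => (f N ω - y ω) * (g N ω - z ω)) +
        ((fun ω => y ω * (g N ω - z ω)) + fun ω => (f N ω - y ω) * z ω) := by
    ext ω; simp only [Pi.add_apply]; ring
  show eLpNorm (fun ω => f N ω * g N ω - y ω * z ω) 1 P ≤ _
  rw [e]
  refine (eLpNorm_add_le b1.1 (b2.add b3).1 le_rfl).trans (add_le_add (hol a1 a2) ?_)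
  exact (eLpNorm_add_le b2.1 b3.1 le_rfl).trans
    (add_le_add (hol hf.memLp_lim a2) (hol a1 hg.memLp_lim))

lemma ConvLp.one_of_two [IsProbabilityMeasure P] (hf : ConvLp P 2 f y) : ConvLp P 1 f y :=
  ⟨fun N => (hf.memLp N).mono_exponent (by norm_num), hf.memLp_lim.mono_exponent (by norm_num),
    tendsto_of_tendsto_of_tendsto_of_le_of_le tendsto_const_nhds hf.tendsto (fun _ => zero_le)
      fun N => eLpNorm_le_eLpNorm_of_exponent_le (by norm_num)
        ((hf.memLp N).sub hf.memLp_lim).1⟩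

lemma ConvLp.tendsto_integral (hf : ConvLp P 1 f y) :
    Tendsto (fun N => ∫ ω, f N ω ∂P) atTop (𝓝 (∫ ω, y ω ∂P)) :=
  tendsto_integral_of_L1' y hf.memLp_lim.1
    (Eventually.of_forall fun N => memLp_one_iff_integrable.1 (hf.memLp N)) hf.tendsto

/-- Uniform moment bounds along an `L¹`-convergent sequence give a tail bound for the limit. -/
lemma ConvLp.tail_le (hf : ConvLp P 1 f y) {r : ℕ} (hr : 1 ≤ r) {b t : ℝ}
    (ht : 0 < t) (hm : ∀ N, MemLp (f N) (2 * r : ℕ) P)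
    (hfb : ∀ N, lpNorm (f N) (2 * r : ℕ) P ≤ b) :
    P {ω | 2 * t ≤ |y ω|} ≤ ENNReal.ofReal ((b / t) ^ (2 * r)) := by
  have h0 : ((2 * r : ℕ) : ℝ≥0∞) ≠ 0 := by exact_mod_cast (by omega : 2 * r ≠ 0)
  have hmeas : TendstoInMeasure P f atTop y :=
    tendstoInMeasure_of_tendsto_eLpNorm one_ne_zero (fun N => (hf.memLp N).1) hf.memLp_lim.1
      hf.tendsto
  rw [tendstoInMeasure_iff_norm] at hmeas
  have hlim := (hmeas t ht).const_add (ENNReal.ofReal ((b / t) ^ (2 * r)))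
  rw [add_zero] at hlim
  refine ge_of_tendsto' hlim fun N => ?_
  -- The second event has vanishing probability and Markov's inequality is applied to `f N` only, so
  -- no moment of order `2 r` of the limit is needed.
  have hsub : {ω | 2 * t ≤ |y ω|} ⊆ {ω | ENNReal.ofReal t ≤ ‖f N ω‖ₑ} ∪
      {ω | t ≤ ‖f N ω - y ω‖} := by
    intro ω hω
    by_cases h : t ≤ |f N ω|
    · left
      show ENNReal.ofReal t ≤ ‖f N ω‖ₑ
      rw [← ofReal_norm]
      exact ENNReal.ofReal_le_ofReal h
    · right
      show t ≤ |f N ω - y ω|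
      have h1 : 2 * t ≤ |y ω| := hω
      have h2 := abs_sub_abs_le_abs_sub (y ω) (f N ω)
      rw [abs_sub_comm] at h2
      linarith [not_le.1 h]
  refine (measure_mono hsub).trans ((measure_union_le _ _).trans (add_le_add_left ?_ _))
  have h1 := mul_meas_ge_le_pow_eLpNorm' P h0 (ENNReal.natCast_ne_top _) (hm N).1
    (ENNReal.ofReal t)
  rw [ENNReal.toReal_natCast, ENNReal.rpow_natCast, ENNReal.rpow_natCast, ← ofReal_lpNorm (hm N),
    ← ENNReal.ofReal_pow ht.le, ← ENNReal.ofReal_pow lpNorm_nonneg] at h1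
  have htp : 0 < t ^ (2 * r) := pow_pos ht _
  rw [div_pow, ENNReal.ofReal_div_of_pos htp,
    ENNReal.le_div_iff_mul_le (Or.inl (by simpa using htp)) (Or.inl ENNReal.ofReal_ne_top), mul_comm]
  exact h1.trans (ENNReal.ofReal_le_ofReal (pow_le_pow_left₀ lpNorm_nonneg (hfb N) _))

end Conv

/-! ### Mean-square convergence of the lag sums. -/

section LagLimit

variable {Ω : Type*} [MeasurableSpace Ω] {P : Measure Ω} {p : ℕ}
  {X : ℤ × Fin p → Ω → ℝ} {A : ℕ → Matrix (Fin p) (Fin p) ℝ}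

lemma IsStandardFamily.lpNorm_two {ι : Type*} {X : ι → Ω → ℝ} (hX : IsStandardFamily P X) (a : ι) :
    lpNorm (X a) (2 * 1 : ℕ) P ≤ 1 := by
  have h := lpNorm_pow_eq_integral (hX.moments a).aestronglyMeasurable le_rfl
  rw [show (2 * 1) = 2 by rfl] at h ⊢
  rw [hX.sq_one] at h
  exact le_of_sq_le_sq (by rw [h]; norm_num) zero_le_one

lemma injective_lagIndex (i : ℤ) :
    Function.Injective fun b : ℕ × Fin p => ((i - b.1, b.2) : ℤ × Fin p) := by
  rintro ⟨m, l⟩ ⟨m', l'⟩ h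
  simp only [Prod.mk.injEq, sub_right_inj, Nat.cast_inj] at h
  exact Prod.ext h.1 h.2

/-- At a fixed time the innovations may be indexed by lag, so coefficients do not depend on `N`; by
injectivity of the index map the family stays standard. -/
lemma lagSum_eq_linForm_lag (N : ℕ) (j : Fin p) (i : ℤ) (x : ℤ × Fin p → ℝ) :
    lagSum A N j i x = linForm (fun b : ℕ × Fin p => A b.1 j b.2)
      (Finset.range N ×ˢ Finset.univ) fun b => x (i - b.1, b.2) := by
  rw [lagSum, linForm, Finset.sum_product]

lemma IsStandardFamily.lagSum_moments (hX : IsStandardFamily P X) (N : ℕ) (j : Fin p) (i : ℤ) :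
    HasAllMoments P (fun ω => lagSum A N j i fun a => X a ω) := by
  simp_rw [lagSum_eq_linForm_lag]
  exact (hX.precomp (injective_lagIndex i)).linForm_moments _ _

lemma IsStandardFamily.integral_lagSum (hX : IsStandardFamily P X) (N : ℕ) (j : Fin p) (i : ℤ) :
    ∫ ω, lagSum A N j i (fun a => X a ω) ∂P = 0 := by
  simp_rw [lagSum_eq_linForm_lag]
  exact (hX.precomp (injective_lagIndex i)).integral_linForm _ _

lemma IsStandardFamily.integral_lagSum_mul_lagSum [IsProbabilityMeasure P]
    (hX : IsStandardFamily P X) (N : ℕ) (j k : Fin p) (i : ℤ) :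
    ∫ ω, lagSum A N j i (fun a => X a ω) * lagSum A N k i (fun a => X a ω) ∂P =
      lagCov A N j k := by
  have h := (hX.precomp (injective_lagIndex i)).integral_quadForm
    (fun a b : ℕ × Fin p => A a.1 j a.2 * A b.1 k b.2) (Finset.range N ×ˢ Finset.univ)
  have e : ∀ x : ℤ × Fin p → ℝ, quadForm (fun a b : ℕ × Fin p => A a.1 j a.2 * A b.1 k b.2)
      (Finset.range N ×ˢ Finset.univ) (fun b => x (i - b.1, b.2)) =
      lagSum A N j i x * lagSum A N k i x - lagCov A N j k := fun x => by
    rw [lagSum_eq_linForm_lag, lagSum_eq_linForm_lag, linForm, linForm, Finset.sum_mul_sum,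
      quadForm, lagCov]
    congr 1
    swap
    · exact Finset.sum_product _ _ _
    exact Finset.sum_congr rfl fun a _ => Finset.sum_congr rfl fun b _ => by ring
  simp_rw [fun ω => e fun a => X a ω] at h
  rw [integral_sub ((hX.lagSum_moments N j i).mul (hX.lagSum_moments N k i)).integrable
    (integrable_const _)] at h
  simp at h
  linarith

/-- The difference is a linear form over the lags in `[N, M)`, whose squared coefficients have a
summable tail. The `5` is that of `lpNorm_linForm_sq_le` at `r = 1`. -/
lemma IsStandardFamily.eLpNorm_lagSum_sub_le [IsProbabilityMeasure P]
    (hX : IsStandardFamily P X) {β C₀ : ℝ}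
    (hA : DecayCondition A β C₀) (h0 : 1 / 2 < β) {N M : ℕ} (h : N ≤ M) (j : Fin p) (i : ℤ) :
    eLpNorm (fun ω => lagSum A M j i (fun a => X a ω) - lagSum A N j i fun a => X a ω) 2 P ≤
      ENNReal.ofReal
        (√(5 * C₀ ^ 2 * ((2 + 1 / (2 * β - 1)) * decay (2 * β - 1) N))) := by
  have hY := hX.precomp (injective_lagIndex (p := p) i)
  have e : ∀ ω, lagSum A M j i (fun a => X a ω) - lagSum A N j i (fun a => X a ω) =
      linForm (fun b : ℕ × Fin p => A b.1 j b.2)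
      (Finset.Ico N M ×ˢ Finset.univ) fun b => X (i - b.1, b.2) ω := fun ω => by
    rw [lagSum, lagSum, linForm, Finset.sum_product, Finset.sum_Ico_eq_sub _ h]
  simp_rw [e]
  have hl := hY.lpNorm_linForm_sq_le (r := 1) le_rfl hY.lpNorm_two
    (fun b : ℕ × Fin p => A b.1 j b.2) (Finset.Ico N M ×ˢ Finset.univ)
  have hmem := hY.linForm_moments (fun b : ℕ × Fin p => A b.1 j b.2)
    (Finset.Ico N M ×ˢ Finset.univ) 2
  rw [show (2 * 1) = 2 by rfl] at hl
  have hs : ∑ b ∈ Finset.Ico N M ×ˢ (Finset.univ : Finset (Fin p)), A b.1 j b.2 ^ 2 ≤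
      C₀ ^ 2 * ((2 + 1 / (2 * β - 1)) * decay (2 * β - 1) N) := by
    rw [Finset.sum_product]
    have h1 : ∀ m ∈ Finset.Ico N M, ∑ l, A m j l ^ 2 ≤ C₀ ^ 2 * decay (2 * β) m := fun m _ => by
      have := (le_abs_self _).trans (abs_sum_row_mul_le hA m m j j)
      rw [decay_mul, ← two_mul] at this
      simpa [sq] using this
    refine (Finset.sum_le_sum h1).trans ?_
    rw [← Finset.mul_sum]
    exact mul_le_mul_of_nonneg_left (sum_Ico_decay_le (by linarith) N M) (sq_nonneg _)
  refine le_trans (ofReal_lpNorm hmem).ge (ENNReal.ofReal_le_ofReal (Real.le_sqrt_of_sq_le ?_))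
  refine hl.trans ?_
  push_cast
  linarith

lemma tendsto_decay {κ : ℝ} (hκ : 0 < κ) : Tendsto (decay κ) atTop (𝓝 0) := by
  refine ((tendsto_rpow_neg_atTop hκ).comp tendsto_natCast_atTop_atTop).congr' ?_
  filter_upwards [eventually_ge_atTop 1] with m hm
  have : (1 : ℝ) ≤ m := by exact_mod_cast hm
  simp [decay, max_eq_right this]

/-- A limit in probability of the lag sums is a limit in mean square. -/
lemma IsStandardFamily.convLp_lagSum [IsProbabilityMeasure P] (hX : IsStandardFamily P X) {β C₀ : ℝ}
    (hA : DecayCondition A β C₀) (h0 : 1 / 2 < β) (j : Fin p) (i : ℤ) {y : Ω → ℝ}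
    (hy : TendstoInMeasure P (fun N ω => lagSum A N j i fun a => X a ω) atTop y) :
    ConvLp P 2 (fun N ω => lagSum A N j i fun a => X a ω) y := by
  have hm : ∀ N, MemLp (fun ω => lagSum A N j i fun a => X a ω) 2 P := fun N =>
    hX.lagSum_moments N j i 2
  have hae : AEStronglyMeasurable y P := hy.aestronglyMeasurable fun N => (hm N).1
  have hbound : ∀ N, eLpNorm (fun ω => y ω - lagSum A N j i fun a => X a ω) 2 P ≤
      ENNReal.ofReal (√(5 * C₀ ^ 2 * ((2 + 1 / (2 * β - 1)) * decay (2 * β - 1) N))) := by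
    intro N
    -- Lower semicontinuity of the norm under convergence in measure lets `M → ∞` in the Cauchy
    -- bound.
    refine eLpNorm_le_of_tendstoInMeasure (u := atTop)
      (f := fun M ω => lagSum A M j i (fun a => X a ω) - lagSum A N j i fun a => X a ω) ?_ ?_
      fun M => ((hm M).sub (hm N)).1
    · filter_upwards [eventually_ge_atTop N] with M hM
      exact hX.eLpNorm_lagSum_sub_le hA h0 hM j i
    · intro ε hε
      simpa only [edist_sub_right] using hy ε hε
  have hmem : MemLp y 2 P := by
    -- A single finite bound shows that `y` is in `L²`, since the lag sums are.
    have h1 : MemLp (fun ω => y ω - lagSum A 0 j i fun a => X a ω) 2 P :=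
      ⟨hae.sub (hm 0).1, (hbound 0).trans_lt ENNReal.ofReal_lt_top⟩
    have h2 := h1.add (hm 0)
    refine h2.ae_eq (Eventually.of_forall fun ω => ?_)
    simp
  refine ⟨hm, hmem, ?_⟩
  have hlim : Tendsto (fun N => ENNReal.ofReal
      (√(5 * C₀ ^ 2 * ((2 + 1 / (2 * β - 1)) * decay (2 * β - 1) N)))) atTop (𝓝 0) := by
    have h1 := ((tendsto_decay (κ := 2 * β - 1) (by linarith)).const_mul
      (2 + 1 / (2 * β - 1))).const_mul (5 * C₀ ^ 2)
    have h2 := ENNReal.tendsto_ofReal (h1.sqrt)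
    simpa using h2
  refine tendsto_of_tendsto_of_tendsto_of_le_of_le tendsto_const_nhds hlim
    (fun _ => zero_le) fun N => ?_
  refine le_trans (le_of_eq ?_) (hbound N)
  exact eLpNorm_sub_comm _ _ _ _

end LagLimit

/-! ### Entries of the sample covariance and their limits. -/

section Entries

variable {Ω : Type*} {p : ℕ}

lemma sampleCov_apply (x : ℤ → Ω → Fin p → ℝ) (n : ℕ) (c : Fin p → ℝ) (ω : Ω) (j k : Fin p) :
    sampleCov x n c ω j k =
      (n : ℝ)⁻¹ * ∑ i ∈ Finset.Icc (1 : ℤ) n, (x i ω j - c j) * (x i ω k - c k) := by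
  simp [sampleCov, Matrix.sum_apply, vecMulVec_apply]

/-- At the true mean `c` this reduces the unknown-mean case to the known-mean one plus a product of
two centred averages. -/
lemma sampleCov_sampleMean_apply (x : ℤ → Ω → Fin p → ℝ) {n : ℕ} (hn : 0 < n) (c : Fin p → ℝ)
    (ω : Ω) (j k : Fin p) :
    sampleCov x n (sampleMean x n ω) ω j k = sampleCov x n c ω j k -
      ((n : ℝ)⁻¹ * ∑ i ∈ Finset.Icc (1 : ℤ) n, (x i ω j - c j)) *
        ((n : ℝ)⁻¹ * ∑ i ∈ Finset.Icc (1 : ℤ) n, (x i ω k - c k)) := by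
  have hn' : (n : ℝ) ≠ 0 := by exact_mod_cast hn.ne'
  have hcard : ((Finset.Icc (1 : ℤ) n).card : ℝ) = n := by simp
  rw [sampleCov_apply, sampleCov_apply]
  have hmean : ∀ l, sampleMean x n ω l =
      (n : ℝ)⁻¹ * ∑ i ∈ Finset.Icc (1 : ℤ) n, (x i ω l - c l) + c l := fun l => by
    simp only [sampleMean, Pi.smul_apply, Finset.sum_apply, smul_eq_mul, Finset.sum_sub_distrib,
      Finset.sum_const, nsmul_eq_mul, hcard]
    field_simp
    ring
  set a := (n : ℝ)⁻¹ * ∑ i ∈ Finset.Icc (1 : ℤ) n, (x i ω j - c j) with ha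
  set b := (n : ℝ)⁻¹ * ∑ i ∈ Finset.Icc (1 : ℤ) n, (x i ω k - c k) with hb
  have ha' : ∑ i ∈ Finset.Icc (1 : ℤ) n, (x i ω j - c j) = n * a := by rw [ha]; field_simp
  have hb' : ∑ i ∈ Finset.Icc (1 : ℤ) n, (x i ω k - c k) = n * b := by rw [hb]; field_simp
  rw [hmean j, hmean k, ← ha, ← hb]
  have e : ∀ i, (x i ω j - (a + c j)) * (x i ω k - (b + c k)) =
      (x i ω j - c j) * (x i ω k - c k) - a * (x i ω k - c k) - b * (x i ω j - c j) + a * b :=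
    fun i => by ring
  simp_rw [e]
  rw [Finset.sum_add_distrib, Finset.sum_sub_distrib, Finset.sum_sub_distrib, ← Finset.mul_sum,
    ← Finset.mul_sum, ha', hb', Finset.sum_const, nsmul_eq_mul, hcard]
  field_simp
  ring

end Entries

section Sample

variable {Ω : Type*} [MeasurableSpace Ω] {P : Measure Ω} {p : ℕ}

lemma IsInnovationArray.isStandardFamily {ξ : ℤ → Fin p → Ω → ℝ} (hξ : IsInnovationArray P ξ)
    {α C : ℝ} (hsub : SubExponential P ξ α C) :
    IsStandardFamily P (fun a : ℤ × Fin p => ξ a.1 a.2) where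
  measurable a := hξ.measurable _ _
  indep := hξ.indep
  mean_zero a := hξ.mean_zero _ _
  sq_one a := by
    rw [← variance_of_integral_eq_zero (hξ.measurable _ _).aemeasurable (hξ.mean_zero _ _)]
    exact hξ.variance_one _ _
  moments a q := by
    rcases Nat.eq_zero_or_pos q with rfl | hq
    · simpa using (hξ.measurable a.1 a.2).aestronglyMeasurable
    · have h := hsub a.1 a.2 q (by exact_mod_cast hq)
      rw [ENNReal.ofReal_natCast] at h
      exact ⟨(hξ.measurable _ _).aestronglyMeasurable, h.trans_lt ENNReal.ofReal_lt_top⟩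

lemma SubExponential.lpNorm_le {ξ : ℤ → Fin p → Ω → ℝ} (hξ : IsInnovationArray P ξ)
    {α C : ℝ} (hC : 0 ≤ C) (hsub : SubExponential P ξ α C) (a : ℤ × Fin p) {q : ℕ} (hq : 1 ≤ q) :
    lpNorm (ξ a.1 a.2) q P ≤ C * (q : ℝ) ^ α := by
  have h := hsub a.1 a.2 q (by exact_mod_cast hq)
  rw [ENNReal.ofReal_natCast] at h
  rw [← toReal_eLpNorm (hξ.measurable _ _).aestronglyMeasurable]
  exact ENNReal.toReal_le_of_le_ofReal (by positivity) h

lemma DecayCondition.mono {A : ℕ → Matrix (Fin p) (Fin p) ℝ} {β β' C₀ : ℝ} (hC₀ : 0 ≤ C₀)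
    (h : β' ≤ β) (hA : DecayCondition A β C₀) : DecayCondition A β' C₀ := fun m j =>
  (hA m j).trans (mul_le_mul_of_nonneg_left (decay_le_of_le h m) hC₀)

lemma IsLinearProcess.tendstoInMeasure_lagSum {A : ℕ → Matrix (Fin p) (Fin p) ℝ}
    {mean : Fin p → ℝ} {ξ : ℤ → Fin p → Ω → ℝ} {x : ℤ → Ω → Fin p → ℝ}
    (hx : IsLinearProcess P A mean ξ x) (i : ℤ) (j : Fin p) :
    TendstoInMeasure P (fun N ω => lagSum A N j i fun a => ξ a.1 a.2 ω) atTop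
      (fun ω => x i ω j - mean j) := by
  intro ε hε
  refine (hx i j ε hε).congr fun N => ?_
  congr 1
  ext ω
  have e : (∑ m ∈ Finset.range N, (A m *ᵥ fun k => ξ (i - m) k ω) j) =
      lagSum A N j i fun a => ξ a.1 a.2 ω := rfl
  simp only [e, Set.mem_ofPred_eq]
  rw [← edist_sub_right _ _ (mean j), add_sub_cancel_left]

/-- The covariances of the truncated process converge to those of the process. -/
lemma tendsto_lagCov [IsProbabilityMeasure P] {A : ℕ → Matrix (Fin p) (Fin p) ℝ}
    {mean : Fin p → ℝ} {X : ℤ × Fin p → Ω → ℝ} {y : Ω → Fin p → ℝ} (hX : IsStandardFamily P X)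
    (i : ℤ)
    (hconv : ∀ j, ConvLp P 2 (fun N ω => lagSum A N j i fun a => X a ω) fun ω => y ω j - mean j)
    (j k : Fin p) :
    Tendsto (fun N => lagCov A N j k) atTop (𝓝 (covMatrix P y j k)) := by
  -- `covMatrix` centres at the expectation, which is identified with `mean` because the lag sums
  -- are centred.
  have hmean : ∀ l, ∫ ω, y ω l ∂P = mean l := by
    intro l
    have h1 := (hconv l).one_of_two.tendsto_integral
    simp only [hX.integral_lagSum] at h1
    have h2 := tendsto_nhds_unique h1 tendsto_const_nhds
    have hint : Integrable (fun ω => y ω l - mean l) P :=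
      memLp_one_iff_integrable.1 (hconv l).one_of_two.memLp_lim
    have h3 : ∫ ω, y ω l ∂P = ∫ ω, ((y ω l - mean l) + mean l) ∂P := by simp
    rw [h3, integral_add hint (integrable_const _), h2]
    simp
  have h4 := ((hconv j).mul (hconv k)).tendsto_integral
  simp only [hX.integral_lagSum_mul_lagSum] at h4
  have e : covMatrix P y j k = ∫ ω, (y ω j - mean j) * (y ω k - mean k) ∂P := by
    change covariance _ _ P = _
    rw [covariance, hmean, hmean]
  rwa [e]

end Sample

/-! ### Concentration of the sample covariance matrix. -/

/-- Tail bound for one entry of the sample covariance matrix. -/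
lemma exists_sampleCovariance_entry_tail_le {β C₀ : ℝ} (h0 : 1 / 2 < β) (h1 : β < 1)
    (h34 : β ≠ 3 / 4) :
    ∃ M : ℝ, 0 < M ∧ ∀ (p n : ℕ) (_ : 0 < n) {Ω : Type*} [MeasurableSpace Ω] {P : Measure Ω}
      [IsProbabilityMeasure P] {ξ : ℤ → Fin p → Ω → ℝ}
      (_ : IsStandardFamily P fun a : ℤ × Fin p => ξ a.1 a.2)
      {A : ℕ → Matrix (Fin p) (Fin p) ℝ} (_ : DecayCondition A β C₀) {mean : Fin p → ℝ}
      {x : ℤ → Ω → Fin p → ℝ} (_ : IsLinearProcess P A mean ξ x)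
      {S : Ω → Matrix (Fin p) (Fin p) ℝ} (_ : IsSampleCovariance x n mean S)
      {r : ℕ} (_ : 1 ≤ r) {K : ℝ} (_ : 1 ≤ K)
      (_ : ∀ a : ℤ × Fin p, lpNorm (ξ a.1 a.2) (4 * r : ℕ) P ≤ K)
      {t : ℝ} (_ : 0 < t) (j k : Fin p),
      P {ω | 2 * t ≤ |S ω j k - covMatrix P (x 0) j k|} ≤ ENNReal.ofReal
        ((M * r ^ 2 * K ^ 2 * (n : ℝ) ^ (-(min (2 * β - 1) (1 / 2))) / t) ^ (2 * r)) := by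
  obtain ⟨M, hM, hbound⟩ := exists_lpNorm_lag_le (C₀ := C₀) h0 h1 h34
  refine ⟨2 * M, by positivity, ?_⟩
  intro p n hn Ω _ P _ ξ hX A hA mean x hx S hS r hr K hK1 hK t ht j k
  set X : ℤ × Fin p → Ω → ℝ := fun a => ξ a.1 a.2 with hXdef
  have hconv : ∀ i j, ConvLp P 2 (fun N ω => lagSum A N j i fun a => X a ω)
      fun ω => x i ω j - mean j := fun i j =>
    hX.convLp_lagSum hA h0 j i (hx.tendstoInMeasure_lagSum i j)
  -- `lagCov` does not depend on the time, so time `0` identifies the centring for all of `1, …, n`.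
  have hcov := tendsto_lagCov (y := x 0) hX 0 (hconv 0) j k
  have hQ := ((ConvLp.sum le_rfl (Finset.Icc (1 : ℤ) n) fun i _ =>
    (hconv i j).mul (hconv i k)).const_mul (n : ℝ)⁻¹).sub le_rfl
      (ConvLp.of_tendsto_const (P := P) le_rfl hcov)
  have hbar : ∀ j, ConvLp P 2 _ _ := fun j =>
    (ConvLp.sum one_le_two (Finset.Icc (1 : ℤ) n) fun i _ => hconv i j).const_mul (n : ℝ)⁻¹
  have hL := (hbar j).mul (hbar k)
  have hLm : ∀ N j i, HasAllMoments P fun ω => lagSum A N j i fun a => X a ω := fun N j i =>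
    hX.lagSum_moments N j i
  have hQm : ∀ N, HasAllMoments P fun ω => (n : ℝ)⁻¹ * ∑ i ∈ Finset.Icc (1 : ℤ) n,
      lagSum A N j i (fun a => X a ω) * lagSum A N k i (fun a => X a ω) - lagCov A N j k :=
    fun N => ((HasAllMoments.sum _ fun i _ => (hLm N j i).mul (hLm N k i)).const_mul _).sub
      (HasAllMoments.const _)
  have hbm : ∀ N j, HasAllMoments P fun ω => (n : ℝ)⁻¹ * ∑ i ∈ Finset.Icc (1 : ℤ) n,
      lagSum A N j i (fun a => X a ω) :=
    fun N j => (HasAllMoments.sum _ fun i _ => hLm N j i).const_mul _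
  have hB0 : 0 ≤ M * r ^ 2 * K ^ 2 * (n : ℝ) ^ (-(min (2 * β - 1) (1 / 2))) := by positivity
  have h2r : (1 : ℝ≥0∞) ≤ (2 * r : ℕ) := by exact_mod_cast (by omega : 1 ≤ 2 * r)
  rcases hS with hS | hS
  · simp_rw [hS, sampleCov_apply]
    refine hQ.tail_le hr ht (fun N => hQm N _) fun N => ?_
    linarith [(hbound p n hn hX hA hr hK1 hK N j k).1]
  · simp_rw [hS, sampleCov_sampleMean_apply x hn mean, sampleCov_apply, sub_right_comm]
    refine (hQ.sub le_rfl hL).tail_le hr ht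
      (fun N => ((hQm N).sub ((hbm N j).mul (hbm N k))) _) fun N => ?_
    obtain ⟨b1, b2⟩ := hbound p n hn hX hA hr hK1 hK N j k
    have := lpNorm_sub_le (g := fun ω => ((n : ℝ)⁻¹ * ∑ i ∈ Finset.Icc (1 : ℤ) n,
      lagSum A N j i (fun a => X a ω)) * ((n : ℝ)⁻¹ * ∑ i ∈ Finset.Icc (1 : ℤ) n,
      lagSum A N k i (fun a => X a ω))) (hQm N (2 * r)) h2r
    refine le_trans this ?_
    linarith

/-- The factor `5/2` suffices because `log p ≥ log 2 > 2/3`. -/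
lemma natCeil_log_le {p : ℕ} (hp : 2 ≤ p) : (⌈Real.log p⌉₊ : ℝ) ≤ 5 / 2 * Real.log p := by
  have h2 : Real.log 2 ≤ Real.log p := Real.log_le_log (by norm_num) (by exact_mod_cast hp)
  have h3 := Real.log_two_gt_d9
  have h4 := (Nat.ceil_lt_add_one (by linarith : 0 ≤ Real.log p)).le
  linarith

/-- Maximum-norm concentration of the sample covariance matrix at the rate `rateJ`. -/
lemma exists_sampleCovariance_tail_le {α β C₀ Cξ : ℝ} (hα : 0 < α) (hβ : 1 / 2 < β)
    (hβ' : β ≠ 3 / 4) (hC₀ : 0 ≤ C₀) (hCξ : 0 < Cξ) :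
    ∃ C₁ : ℝ, 0 < C₁ ∧ ∀ (p n : ℕ) (_ : 2 ≤ p) (_ : 0 < n) {Ω : Type*} [MeasurableSpace Ω]
      {P : Measure Ω} [IsProbabilityMeasure P] {A : ℕ → Matrix (Fin p) (Fin p) ℝ}
      {mean : Fin p → ℝ} {ξ : ℤ → Fin p → Ω → ℝ} {x : ℤ → Ω → Fin p → ℝ}
      (_ : DecayCondition A β C₀) (_ : IsInnovationArray P ξ) (_ : SubExponential P ξ α Cξ)
      (_ : IsLinearProcess P A mean ξ x)
      {S : Ω → Matrix (Fin p) (Fin p) ℝ} (_ : IsSampleCovariance x n mean S),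
      P {ω | ∃ j k, C₁ * rateJ n p β α < |S ω j k - covMatrix P (x 0) j k|} ≤
        ENNReal.ofReal ((p : ℝ) ^ (-2 : ℝ)) := by
  -- Lowering `β` only weakens the decay condition. The cap gives `β₀ < 1`, needed for the
  -- autocovariance bound, and being above `3/4` it leaves the rate unchanged.
  set β₀ := min β (9 / 10) with hβ₀
  have hb1 : 1 / 2 < β₀ := lt_min hβ (by norm_num)
  have hb2 : β₀ < 1 := (min_le_right _ _).trans_lt (by norm_num)
  have hb3 : β₀ ≠ 3 / 4 := by
    rcases min_choice β (9 / 10) with h | h <;> rw [hβ₀, h]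
    · exact hβ'
    · norm_num
  have hexp : min (2 * β₀ - 1) (1 / 2) = min (2 * β - 1) (1 / 2) := by
    rcases le_total β (9 / 10) with h | h
    · rw [hβ₀, min_eq_left h]
    · rw [hβ₀, min_eq_right h, min_eq_right (by norm_num), min_eq_right (by linarith)]
  obtain ⟨M, hM, htail⟩ := exists_sampleCovariance_entry_tail_le (C₀ := C₀) hb1 hb2 hb3
  refine ⟨2 * Real.exp 2 * M * (1 + Cξ) ^ 2 * ((4 : ℝ) ^ α) ^ 2 * (5 / 2 : ℝ) ^ (2 * α + 2),
    by positivity, ?_⟩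
  intro p n hp hn Ω _ P _ A mean ξ x hA hξ hsub hx S hS
  have hX := hξ.isStandardFamily hsub
  have hp' : (2 : ℝ) ≤ p := by exact_mod_cast hp
  have hp0 : (0 : ℝ) < p := by linarith
  have hlog : 0 < Real.log p := Real.log_pos (by linarith)
  set r := ⌈Real.log p⌉₊ with hr
  have hr1 : 1 ≤ r := Nat.ceil_pos.2 hlog
  have hr0 : (0 : ℝ) < r := by exact_mod_cast hr1
  -- The moment bound at order `4 r`, with `1 + Cξ` for `Cξ` so that `K ≥ 1`.
  set K := (1 + Cξ) * ((4 * r : ℕ) : ℝ) ^ α with hK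
  have hpow : (1 : ℝ) ≤ ((4 * r : ℕ) : ℝ) ^ α :=
    Real.one_le_rpow (by exact_mod_cast (by omega : 1 ≤ 4 * r)) hα.le
  have hK1 : 1 ≤ K := by rw [hK]; nlinarith
  have hKb : ∀ a : ℤ × Fin p, lpNorm (ξ a.1 a.2) (4 * r : ℕ) P ≤ K := fun a => by
    refine (hsub.lpNorm_le hξ hCξ.le a (by omega)).trans ?_
    rw [hK]; nlinarith
  set ρ := (n : ℝ) ^ (-(min (2 * β₀ - 1) (1 / 2))) with hρ
  have hn0 : (0 : ℝ) < n := by exact_mod_cast hn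
  have hρ0 : 0 < ρ := Real.rpow_pos_of_pos hn0 _
  set b := M * r ^ 2 * K ^ 2 * ρ with hb
  have hb0 : 0 < b := by positivity
  -- With this `t` the tail `(b / t) ^ (2 r)` is `exp (-4 r) ≤ p⁻⁴`, small enough for a union over
  -- `p²` entries.
  set t := Real.exp 2 * b with ht
  have ht0 : 0 < t := by positivity
  have hrate : 2 * t ≤ 2 * Real.exp 2 * M * (1 + Cξ) ^ 2 * ((4 : ℝ) ^ α) ^ 2 *
      (5 / 2 : ℝ) ^ (2 * α + 2) * rateJ n p β α := by
    have e1 : (r : ℝ) ^ 2 * K ^ 2 =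
        (1 + Cξ) ^ 2 * ((4 : ℝ) ^ α) ^ 2 * (r : ℝ) ^ (2 * α + 2) := by
      have : (r : ℝ) ^ (2 * α + 2) = ((r : ℝ) ^ α) ^ 2 * (r : ℝ) ^ 2 := by
        rw [Real.rpow_add hr0, Real.rpow_two, mul_comm 2 α, Real.rpow_mul hr0.le, Real.rpow_two]
      rw [hK, Nat.cast_mul, Real.mul_rpow (by positivity) (by positivity), this]
      push_cast
      ring
    have e2 : (r : ℝ) ^ (2 * α + 2) ≤
        (5 / 2 : ℝ) ^ (2 * α + 2) * Real.log p ^ (2 * α + 2) := by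
      rw [← Real.mul_rpow (by norm_num) hlog.le]
      exact Real.rpow_le_rpow hr0.le (natCeil_log_le hp) (by linarith)
    have e3 : 2 * t = 2 * Real.exp 2 * M * ((r : ℝ) ^ 2 * K ^ 2) * ρ := by rw [ht, hb]; ring
    rw [e3, e1, rateJ, ← hexp, ← hρ]
    calc _ ≤ 2 * Real.exp 2 * M * ((1 + Cξ) ^ 2 * ((4 : ℝ) ^ α) ^ 2 *
          ((5 / 2 : ℝ) ^ (2 * α + 2) * Real.log p ^ (2 * α + 2))) * ρ := by gcongr
      _ = _ := by ring
  have hentry : ∀ j k, P {ω | 2 * t ≤ |S ω j k - covMatrix P (x 0) j k|} ≤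
      ENNReal.ofReal ((p : ℝ) ^ (-4 : ℝ)) := fun j k => by
    refine (htail p n hn hX (hA.mono hC₀ (min_le_left _ _)) hx hS hr1 hK1 hKb ht0 j k).trans
      (ENNReal.ofReal_le_ofReal ?_)
    have e1 : M * (r : ℝ) ^ 2 * K ^ 2 * ρ / t = Real.exp (-2) := by
      rw [← hb, ht, Real.exp_neg]; field_simp
    rw [e1, ← Real.exp_nat_mul, Real.rpow_def_of_pos hp0]
    refine Real.exp_le_exp.2 ?_
    have := Nat.le_ceil (Real.log p)
    push_cast
    linarith
  have hcover : {ω | ∃ j k, 2 * Real.exp 2 * M * (1 + Cξ) ^ 2 * ((4 : ℝ) ^ α) ^ 2 *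
      (5 / 2 : ℝ) ^ (2 * α + 2) * rateJ n p β α < |S ω j k - covMatrix P (x 0) j k|} ⊆
      ⋃ jk : Fin p × Fin p, {ω | 2 * t ≤ |S ω jk.1 jk.2 - covMatrix P (x 0) jk.1 jk.2|} := by
    rintro ω ⟨j, k, h⟩
    exact Set.mem_iUnion.2 ⟨(j, k), hrate.trans h.le⟩
  refine (measure_mono hcover).trans ((measure_iUnion_fintype_le _ _).trans ?_)
  refine (Finset.sum_le_sum fun jk _ => hentry jk.1 jk.2).trans (le_of_eq ?_)
  rw [Finset.sum_const, nsmul_eq_mul, Finset.card_univ, Fintype.card_prod, Fintype.card_fin,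
    ← ENNReal.ofReal_natCast, ← ENNReal.ofReal_mul (by positivity)]
  congr 1
  rw [Nat.cast_mul, ← sq, ← Real.rpow_two, ← Real.rpow_add hp0]
  norm_num

lemma tailBound_nonneg (p : ℕ) (C : ℝ≥0∞) : 0 ≤ tailBound p C := by
  unfold tailBound
  split_ifs <;> positivity

end LinFunctional

/-! ### The two parts combined. -/

theorem theorem2 (α β C₀ Cξ : ℝ) (hα : 1 / 2 < α) (hβ : 1 / 2 < β) (hβ' : β ≠ 3 / 4)
    (hC₀ : 0 < C₀) (hCξ : 0 < Cξ) :
    ∃ C₁ C₂ C₃ : ℝ, 0 < C₁ ∧ 0 < C₂ ∧ 0 < C₃ ∧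
      ∀ (p n : ℕ), 0 < p → 0 < n →
      ∀ (Ω : Type*) [MeasurableSpace Ω] (P : Measure Ω) [IsProbabilityMeasure P]
        (A : ℕ → Matrix (Fin p) (Fin p) ℝ) (mean : Fin p → ℝ)
        (ξ : ℤ → Fin p → Ω → ℝ) (x : ℤ → Ω → Fin p → ℝ),
      DecayCondition A β C₀ →
      IsInnovationArray P ξ →
      SubExponential P ξ α Cξ →
      IsLinearProcess P A mean ξ x →
      ∀ S : Ω → Matrix (Fin p) (Fin p) ℝ, IsSampleCovariance x n mean S →
      ∀ Sig : Matrix (Fin p) (Fin p) ℝ, Sig = covMatrix P (x 0) → IsUnit Sig.det →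
      ∀ (b θ : Fin p → ℝ), θ = Sig⁻¹ *ᵥ b →
      ∀ (bhat : Ω → Fin p → ℝ), Measurable bhat →
      ∀ (cb rb : ℝ) (Cb : ℝ≥0∞), 0 < cb → 0 ≤ rb → 0 < Cb →
      P {ω | cb * rb < ‖bhat ω - b‖} ≤ ENNReal.ofReal (tailBound p Cb) →
      ∀ lam : ℝ, cb * rb + C₁ * l1 θ * rateJ n p β α ≤ lam →
      ∃ E : Set Ω, MeasurableSet E ∧
        1 - tailBound p Cb - C₂ * (p : ℝ) ^ (-C₃) ≤ P.real E ∧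
        ∀ ω ∈ E, (dantzigArgmin (S ω) (bhat ω) lam).Nonempty ∧
          ∀ θhat ∈ dantzigArgmin (S ω) (bhat ω) lam, ∀ w : ℝ≥0∞, 1 ≤ w →
            lw w (θhat - θ) ≤
              (6 * smallness θ (5 * matL1 Sig⁻¹ * lam)) ^ (1 / w).toReal *
                (2 * matL1 Sig⁻¹ * lam) ^ (1 - (1 / w).toReal) := by
  obtain ⟨C₁, hC₁, hconc⟩ :=
    exists_sampleCovariance_tail_le (α := α) (by linarith) hβ hβ' hC₀.le hCξ
  refine ⟨C₁, 1, 2, hC₁, one_pos, two_pos, ?_⟩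
  intro p n hp hn Ω _ P _ A mean ξ x hA hξ hsub hx S hS Sig hSig hdet b θ hθ bhat _ cb rb Cb
    _ _ _ hbhat lam hlam
  have htb := tailBound_nonneg p Cb
  rcases Nat.lt_or_ge p 2 with hp1 | hp2
  -- Here `log p = 0`, so `rateJ` vanishes and no concentration is available; but `C₂ * 1 ^ (-C₃) =
  -- 1`, so the probability claimed is at most `0` and the empty event serves.
  · obtain rfl : p = 1 := by omega
    refine ⟨∅, MeasurableSet.empty, ?_, fun ω hω => hω.elim⟩
    simp [htb]
  · set bad : Set Ω := {ω | cb * rb < ‖bhat ω - b‖} ∪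
      {ω | ∃ j k, C₁ * rateJ n p β α < |S ω j k - covMatrix P (x 0) j k|} with hbad
    have hPbad : P bad ≤ ENNReal.ofReal (tailBound p Cb + (p : ℝ) ^ (-2 : ℝ)) := by
      rw [ENNReal.ofReal_add htb (by positivity)]
      exact (measure_union_le _ _).trans
        (add_le_add hbhat (hconc p n hp2 hn hA hξ hsub hx hS))
    -- The process is not assumed measurable, so `bad` need not be; its measurable hull has the same
    -- probability.
    refine ⟨(toMeasurable P bad)ᶜ, (measurableSet_toMeasurable P bad).compl, ?_, ?_⟩
    · rw [probReal_compl_eq_one_sub (measurableSet_toMeasurable P bad), Measure.real,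
        measure_toMeasurable]
      have := ENNReal.toReal_le_of_le_ofReal (by positivity) hPbad
      linarith
    · intro ω hω
      have hω' : ω ∉ bad := fun h => hω (subset_toMeasurable P bad h)
      simp only [hbad, Set.mem_union, Set.mem_ofPred_eq, not_or, not_exists, not_lt] at hω'
      have hJ : 0 ≤ C₁ * rateJ n p β α := by
        have := Real.log_natCast_nonneg p
        rw [rateJ]; positivity
      refine dantzig_error_bound (S ω) Sig ?_ hdet b (bhat ω) θ hθ hJ ?_ hω'.1 ?_
      · rw [hSig]
        ext j k
        exact covariance_comm _ _
      · rw [hSig]; exact hω'.2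
      · linarith
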